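/- Let $k$ be a field. A finite abelian category is a $k$-linear category that is equivalent, as a $k$-linear category, to the category of finite-dimensional left modules over some finite-dimensional $k$-algebra. The Nakayama functor of a $k$-linear category $\mathcal{A}$ is the endofunctor $$\mathbb{N}_{\mathcal{A}}(M) = \int^{X \in \mathcal{A}} \mathrm{Hom}_{\mathcal{A}}(M, X)^* \odot X \qquad (M \in \mathcal{A}),$$ provided that the copowers and coends exist; here the copower $V \odot X$ of $X \in \mathcal{A}$ by a vector space $V$ is the object with natural isomorphisms $\mathrm{Hom}_{\mathcal{A}}(V \odot X, Y) \cong \mathrm{Hom}_k(V, \mathrm{Hom}_{\mathcal{A}}(X, Y))$. For a functor $F$, write $F^{\mathrm{la}}$, $F^{\mathrm{ra}}$ for a left and a right adjoint. If $G : \mathcal{A} \to \mathcal{B}$ is a $k$-linear functor between $k$-linear categories with Nakayama functors and $G \dashv G^{\mathrm{ra}} \dashv G^{\mathrm{rra}} \dashv G^{\mathrm{rrra}}$, let $\mathrm{can}_G : G^{\mathrm{rra}} \mathbb{N}_{\mathcal{A}} \to \mathbb{N}_{\mathcal{B}} G$ be the canonical morphism $$G^{\mathrm{rra}} \int^{X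 \in \mathcal{A}} \mathrm{Hom}(M, X)^* \odot X \cong \int^{X \in \mathcal{A}} \mathrm{Hom}(M, X)^* \odot G^{\mathrm{rra}} X \cong \int^{Y \in \mathcal{B}} \mathrm{Hom}(M, G^{\mathrm{ra}} Y)^* \odot Y \cong \int^{Y \in \mathcal{B}} \mathrm{Hom}(G M, Y)^* \odot Y$$ induced by the adjunctions. Let $\mathcal{M}$ be a finite abelian category over $k$, and let $\mathbf{T} = (T, \mu, \eta)$ be a monad on $\mathcal{M}$ such that $T$ is $k$-linear and adjunctions $T^{\mathrm{lla}} \dashv T^{\mathrm{la}} \dashv T \dashv T^{\mathrm{ra}} \dashv T^{\mathrm{rra}}$ exist (and are chosen). Let $\mathbf{T}^{\mathrm{lla}}$ be the monad with underlying functor $T^{\mathrm{lla}}$ whose structure morphisms are the twofold conjugates of $\mu$ and $\eta$. Then $T^{\mathrm{la}}$ is a right $\mathbf{T}$-module by the natural transformation $b : T^{\mathrm{la}} T \to T^{\mathrm{la}}$ that corresponds under $T^{\mathrm{la}} \dashv T$ to the composite $T \to T T T^{\mathrm{la}} \to T T^{\mathrm{la}}$ of the unit of this adjunction and $\mu$,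 and it is a left $\mathbf{T}^{\mathrm{lla}}$-module by the natural transformation $T^{\mathrm{lla}} T^{\mathrm{la}} \to T^{\mathrm{la}}$ that corresponds under $T^{\mathrm{lla}} \dashv T^{\mathrm{la}}$ to the conjugate $T^{\mathrm{la}} \to T^{\mathrm{la}} T^{\mathrm{la}}$ of $\mu$. For a $\mathbf{T}$-module $\mathbf{M} = (M, a_M)$, let $\mathbf{T}^{\mathrm{la}} \otimes_{\mathbf{T}} \mathbf{M}$ be the coequalizer of $b_M$ and $T^{\mathrm{la}}(a_M) : T^{\mathrm{la}} T M \to T^{\mathrm{la}} M$, which is a $\mathbf{T}^{\mathrm{lla}}$-module by the action induced by the left action on $T^{\mathrm{la}}$. Then the Nakayama functors of $\mathcal{M}$ and of the category $\mathbf{T}\text{-mod}$ of $\mathbf{T}$-modules exist, and $\mathbb{N}_{\mathbf{T}\text{-mod}}$ is naturally isomorphic to the composite $$\mathbf{T}\text{-mod} \xrightarrow{\ \mathbf{T}^{\mathrm{la}} \otimes_{\mathbf{T}} (-)\ } \mathbf{T}^{\mathrm{lla}}\text{-mod} \longrightarrow \mathbf{T}\text{-mod},$$ where the second functor is the lift of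 $\mathbb{N}_{\mathcal{M}}$ that sends $(M, a_M)$ to $\mathbb{N}_{\mathcal{M}}(M)$ with the action $$T\, \mathbb{N}_{\mathcal{M}}(M) \xrightarrow{\ \mathrm{can}_{T^{\mathrm{lla}}}(M)\ } \mathbb{N}_{\mathcal{M}}(T^{\mathrm{lla}} M) \xrightarrow{\ \mathbb{N}_{\mathcal{M}}(a_M)\ } \mathbb{N}_{\mathcal{M}}(M).$$ -/

import Mathlib

open CategoryTheory CategoryTheory.Limits Opposite

universe u v w v' w'

noncomputable section

namespace NakMonad

/-! ## Linear categories, finite abelian categories -/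

section Finite

/-- A `k`-linear category is a *finite abelian category* if it is equivalent, as a `k`-linear
category, to the category of finite-dimensional left modules over some finite-dimensional
`k`-algebra `A` (over such an `A`, finitely generated and finite-dimensional modules agree). -/
class FiniteAbelian (k : Type u) [Field k] (C : Type w) [Category.{v} C] [Preadditive C]
    [Linear k C] : Prop where
  exists_equivalence : ∃ (A : Type u) (_ : Ring A) (_ : Algebra k A)
    (F : C ⥤ FGModuleCat.{u} A),
    Module.Finite k A ∧ F.IsEquivalence ∧ F.Additive ∧ F.Linear k

end Finite

section AlgebraLinear

variable (k : Type u) [Field k] {C : Type w} [Category.{v} C] [Preadditive C] [Linear k C]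
variable (T : Monad C) [T.toFunctor.Additive] [T.toFunctor.Linear k]

/-- The `k`-linear structure on the category of modules over a linear monad. -/
instance algebraLinear : Linear k T.Algebra where
  homModule M N :=
    { smul := fun r f =>
        { f := r • f.f
          h := by rw [Functor.map_smul, Linear.smul_comp, f.h, Linear.comp_smul] }
      one_smul := fun f => Monad.Algebra.Hom.ext (one_smul k f.f)
      mul_smul := fun r s f => Monad.Algebra.Hom.ext (mul_smul r s f.f)
      smul_zero := fun r => Monad.Algebra.Hom.ext (smul_zero r)
      smul_add := fun r f g => Monad.Algebra.Hom.ext (smul_add r f.f g.f)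
      add_smul := fun r s f => Monad.Algebra.Hom.ext (add_smul r s f.f)
      zero_smul := fun f => Monad.Algebra.Hom.ext (zero_smul k f.f) }
  smul_comp _ _ _ r f g := Monad.Algebra.Hom.ext (Linear.smul_comp _ _ _ r f.f g.f)
  comp_smul _ _ _ f r g := Monad.Algebra.Hom.ext (Linear.comp_smul _ _ _ f.f r g.f)

end AlgebraLinear

/-! ## Copowers -/

section Copower

variable (k : Type u) [Field k] {C : Type w} [Category.{v} C] [Preadditive C] [Linear k C]

/-- `P`, with the linear map `i : V → Hom(X, P)`, represents the functor
`Y ↦ Hom_k(V, Hom(X, Y))`. -/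
def IsCopower (V : Type v') [AddCommGroup V] [Module k V] (X P : C) (i : V →ₗ[k] (X ⟶ P)) :
    Prop :=
  ∀ (Y : C) (g : V →ₗ[k] (X ⟶ Y)), ∃! f : P ⟶ Y, ∀ x : V, i x ≫ f = g x

/-- Existence of the copower of `X` by the vector space `V`. -/
class HasCopower (V : Type v') [AddCommGroup V] [Module k V] (X : C) : Prop where
  exists_isCopower : ∃ (P : C) (i : V →ₗ[k] (X ⟶ P)), IsCopower k V X P i

variable (V : Type v') [AddCommGroup V] [Module k V] (X : C) [HasCopower k V X]

/-- The copower `V ⊙ X`. -/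
def copower : C := (HasCopower.exists_isCopower (k := k) (V := V) (X := X)).choose

/-- The universal linear map `V → Hom(X, V ⊙ X)`. -/
def copowerι : V →ₗ[k] (X ⟶ copower k V X) :=
  (HasCopower.exists_isCopower (k := k) (V := V) (X := X)).choose_spec.choose

theorem isCopower_copower : IsCopower k V X (copower k V X) (copowerι k V X) :=
  (HasCopower.exists_isCopower (k := k) (V := V) (X := X)).choose_spec.choose_spec

variable {k V X}

/-- The morphism `V ⊙ X ⟶ Y` corresponding to a linear map `V → Hom(X, Y)`. -/
def copowerDesc {Y : C} (g : V →ₗ[k] (X ⟶ Y)) : copower k V X ⟶ Y :=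
  (isCopower_copower k V X Y g).choose

@[simp]
theorem copowerι_desc {Y : C} (g : V →ₗ[k] (X ⟶ Y)) (x : V) :
    copowerι k V X x ≫ copowerDesc g = g x :=
  (isCopower_copower k V X Y g).choose_spec.1 x

@[simp]
theorem copowerι_desc_assoc {Y Z : C} (g : V →ₗ[k] (X ⟶ Y)) (x : V) (h : Y ⟶ Z) :
    copowerι k V X x ≫ copowerDesc g ≫ h = g x ≫ h := by
  rw [← Category.assoc, copowerι_desc]

theorem copower_hom_ext {Y : C} {f g : copower k V X ⟶ Y}
    (h : ∀ x : V, copowerι k V X x ≫ f = copowerι k V X x ≫ g) : f = g :=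
  (isCopower_copower k V X Y ((Linear.rightComp k X g).comp (copowerι k V X))).unique h
    (fun _ => rfl)

/-- Functoriality of the copower in both variables. -/
def copowerMap {V' : Type v'} [AddCommGroup V'] [Module k V'] {X' : C} [HasCopower k V' X']
    (φ : V →ₗ[k] V') (f : X ⟶ X') : copower k V X ⟶ copower k V' X' :=
  copowerDesc ((Linear.leftComp k _ f).comp ((copowerι k V' X').comp φ))

@[simp]
theorem copowerι_map {V' : Type v'} [AddCommGroup V'] [Module k V'] {X' : C} [HasCopower k V' X']
    (φ : V →ₗ[k] V') (f : X ⟶ X') (x : V) :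
    copowerι k V X x ≫ copowerMap φ f = f ≫ copowerι k V' X' (φ x) := by
  simp [copowerMap]

@[simp]
theorem copowerι_map_assoc {V' : Type v'} [AddCommGroup V'] [Module k V'] {X' : C}
    [HasCopower k V' X'] (φ : V →ₗ[k] V') (f : X ⟶ X') (x : V) {Z : C}
    (h : copower k V' X' ⟶ Z) :
    copowerι k V X x ≫ copowerMap φ f ≫ h = f ≫ copowerι k V' X' (φ x) ≫ h := by
  simp [copowerMap]

end Copower

/-! ## The Nakayama functor -/

section Nakayama

variable (k : Type u) [Field k] {C : Type w} [Category.{v} C] [Preadditive C] [Linear k C]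

/-- The map `Hom(M, Y)^* → Hom(M, X)^*` induced by `f : X ⟶ Y`. -/
abbrev dualPost (M : C) {X Y : C} (f : X ⟶ Y) :
    Module.Dual k (M ⟶ Y) →ₗ[k] Module.Dual k (M ⟶ X) :=
  (Linear.rightComp k M f).dualMap

/-- The map `Hom(M, X)^* → Hom(N, X)^*` induced by `f : M ⟶ N`. -/
abbrev dualPre {M N : C} (f : M ⟶ N) (X : C) :
    Module.Dual k (M ⟶ X) →ₗ[k] Module.Dual k (N ⟶ X) :=
  (Linear.leftComp k X f).dualMap

/-- The bifunctor `(X, Y) ↦ Hom(M, X)^* ⊙ Y`, contravariant in `X` and covariant in `Y`. -/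
abbrev nakayamaBifunctor [∀ M X Y : C, HasCopower k (Module.Dual k (M ⟶ X)) Y] (M : C) :
    Cᵒᵖ ⥤ C ⥤ C where
  obj X :=
    { obj := fun Y => copower k (Module.Dual k (M ⟶ X.unop)) Y
      map := fun f => copowerMap LinearMap.id f
      map_id := fun Y => copower_hom_ext (by simp)
      map_comp := fun f g => copower_hom_ext (by simp) }
  map f :=
    { app := fun Y => copowerMap (dualPost k M f.unop) (𝟙 Y)
      naturality := fun Y Z g => copower_hom_ext (by simp) }
  map_id X := by
    ext Y
    refine copower_hom_ext (fun φ => ?_)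
    have : dualPost k M (𝟙 X.unop) φ = φ := by ext; simp
    simp [this]
  map_comp f g := by
    ext Y
    refine copower_hom_ext (fun φ => ?_)
    have : dualPost k M (g.unop ≫ f.unop) φ = dualPost k M g.unop (dualPost k M f.unop φ) := by
      ext; simp
    simp [this]

variable (C) in
/-- Existence of the copowers `Hom(M, X)^* ⊙ Y` and of the coends
`∫^X Hom(M, X)^* ⊙ X`, i.e. existence of the Nakayama functor of `C`. -/
class HasNakayama : Prop where
  hasCopower : ∀ M X Y : C, HasCopower k (Module.Dual k (M ⟶ X)) Y
  hasCoend : ∀ M : C, HasCoend (nakayamaBifunctor k M)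

attribute [instance] HasNakayama.hasCopower HasNakayama.hasCoend

variable [HasNakayama k C]

/-- Naturality of `Hom(M, X)^* ⊙ Y` in `M`. -/
abbrev nakayamaBifunctorMap {M N : C} (f : M ⟶ N) :
    nakayamaBifunctor k M ⟶ nakayamaBifunctor k N where
  app X :=
    { app := fun Y => copowerMap (dualPre k f X.unop) (𝟙 Y)
      naturality := fun Y Z g => copower_hom_ext (by simp) }
  naturality X Y g := by
    ext Z
    refine copower_hom_ext (fun φ => ?_)
    have : dualPre k f Y.unop (dualPost k M g.unop φ) =
        dualPost k N g.unop (dualPre k f X.unop φ) := by ext; simp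
    simp [this]

variable (C) in
/-- The Nakayama functor `M ↦ ∫^{X ∈ C} Hom(M, X)^* ⊙ X`. -/
def nakayama : C ⥤ C where
  obj M := coend (nakayamaBifunctor k M)
  map f := coend.map (nakayamaBifunctorMap k f)
  map_id M := by
    refine coend.hom_ext (fun X => copower_hom_ext (fun φ => ?_))
    have : dualPre k (𝟙 M) X φ = φ := by ext; simp
    simp [this]
  map_comp {M N P} f g := by
    refine coend.hom_ext (fun X => copower_hom_ext (fun φ => ?_))
    have : dualPre k (f ≫ g) X φ = dualPre k g X (dualPre k f X φ) := by ext; simp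
    simp [this]

/-- The universal dinatural transformation of the coend `∫^X Hom(M, X)^* ⊙ X`, written as a
family of linear maps `Hom(M, X)^* → Hom(X, Nak(M))`. -/
def nakι (M X : C) : Module.Dual k (M ⟶ X) →ₗ[k] (X ⟶ (nakayama k C).obj M) :=
  (Linear.rightComp k X (coend.ι (nakayamaBifunctor k M) X)).comp (copowerι k _ X)

theorem nakι_apply (M X : C) (φ : Module.Dual k (M ⟶ X)) :
    nakι k M X φ = copowerι k _ X φ ≫ coend.ι (nakayamaBifunctor k M) X := rfl

theorem nakι_dinatural (M : C) {X Y : C} (f : X ⟶ Y) (φ : Module.Dual k (M ⟶ Y)) :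
    nakι k M X (dualPost k M f φ) = f ≫ nakι k M Y φ := by
  have h := copowerι k _ X φ ≫= coend.condition (nakayamaBifunctor k M) f
  simpa [nakι_apply] using! h

theorem nak_hom_ext {M Y : C} {f g : (nakayama k C).obj M ⟶ Y}
    (h : ∀ (X : C) (φ : Module.Dual k (M ⟶ X)), nakι k M X φ ≫ f = nakι k M X φ ≫ g) : f = g :=
  coend.hom_ext (fun X => copower_hom_ext (fun φ =>
    (Category.assoc _ _ _).symm.trans ((h X φ).trans (Category.assoc _ _ _))))

theorem nakι_map {M N : C} (f : M ⟶ N) (X : C) (φ : Module.Dual k (M ⟶ X)) :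
    nakι k M X φ ≫ (nakayama k C).map f = nakι k N X (dualPre k f X φ) := by
  change (copowerι k _ X φ ≫ coend.ι (nakayamaBifunctor k M) X) ≫
    coend.map (nakayamaBifunctorMap k f) = _
  simp [nakι_apply]

/-- The morphism out of `Nak(M)` determined by a dinatural family. -/
def nakDesc {M Y : C} (d : ∀ X : C, Module.Dual k (M ⟶ X) →ₗ[k] (X ⟶ Y))
    (hd : ∀ ⦃X X' : C⦄ (f : X ⟶ X') (φ : Module.Dual k (M ⟶ X')),
      d X (dualPost k M f φ) = f ≫ d X' φ) : (nakayama k C).obj M ⟶ Y :=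
  coend.desc (F := nakayamaBifunctor k M) (fun X => copowerDesc (d X))
    (fun X X' f => copower_hom_ext (fun φ => by simpa using hd f φ))

theorem nakι_desc {M Y : C} (d : ∀ X : C, Module.Dual k (M ⟶ X) →ₗ[k] (X ⟶ Y))
    (hd : ∀ ⦃X X' : C⦄ (f : X ⟶ X') (φ : Module.Dual k (M ⟶ X')),
      d X (dualPost k M f φ) = f ≫ d X' φ) (X : C) (φ : Module.Dual k (M ⟶ X)) :
    nakι k M X φ ≫ nakDesc k d hd = d X φ := by
  refine (Category.assoc (copowerι k _ X φ) (coend.ι (nakayamaBifunctor k M) X) _).trans ?_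
  simp [nakDesc]

end Nakayama

/-! ## The canonical morphism `G^rr Nak_C ⟶ Nak_D G` -/

section Canonical

variable (k : Type u) [Field k] {C : Type w} [Category.{v} C] [Preadditive C] [Linear k C]
theorem map_nak_hom_ext [HasNakayama k C] {D : Type w'} [Category.{v'} D] {G₂ : C ⥤ D} {G₃ : D ⥤ C}
    (adj₃ : G₂ ⊣ G₃) {M : C} {Y : D} {f g : G₂.obj ((nakayama k C).obj M) ⟶ Y}
    (h : ∀ (X : C) (φ : Module.Dual k (M ⟶ X)),
      G₂.map (nakι k M X φ) ≫ f = G₂.map (nakι k M X φ) ≫ g) : f = g := by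
  apply (adj₃.homEquiv _ _).injective
  refine nak_hom_ext k (fun X φ => ?_)
  rw [← Adjunction.homEquiv_naturality_left, ← Adjunction.homEquiv_naturality_left, h]

variable {D : Type w'} [Category.{v'} D] [Preadditive D] [Linear k D]

theorem homEquiv_smul {F : C ⥤ D} {G : D ⥤ C} (adj : F ⊣ G) [F.Linear k] {X : C} {Y : D}
    (r : k) (f : F.obj X ⟶ Y) : adj.homEquiv X Y (r • f) = r • adj.homEquiv X Y f := by
  apply (adj.homEquiv X Y).symm.injective
  rw [Equiv.symm_apply_apply, Adjunction.homEquiv_counit, Functor.map_smul, Linear.smul_comp,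
    ← Adjunction.homEquiv_counit, Equiv.symm_apply_apply]

theorem rightAdjoint_linear {F : C ⥤ D} {G : D ⥤ C} (adj : F ⊣ G) [F.Linear k] :
    G.Linear k where
  map_smul {X Y} f r := by
    have h : G.map (r • f) = adj.homEquiv _ _ (r • (adj.counit.app X ≫ f)) := by
      rw [← Linear.comp_smul, Adjunction.homEquiv_naturality_right]
      simp [Adjunction.homEquiv_unit]
    rw [h, homEquiv_smul, Adjunction.homEquiv_naturality_right]
    simp [Adjunction.homEquiv_unit]

theorem leftAdjoint_linear {F : C ⥤ D} {G : D ⥤ C} (adj : F ⊣ G) [G.Linear k] :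
    F.Linear k where
  map_smul {X Y} f r := by
    apply (adj.homEquiv _ _).injective
    rw [Adjunction.homEquiv_unit, Adjunction.homEquiv_unit, G.map_smul, Linear.comp_smul,
      Adjunction.unit_naturality, Adjunction.unit_naturality, Linear.smul_comp]

/-- The adjunction isomorphism `Hom(F X, Y) ≅ Hom(X, G Y)` as a linear map. -/
def homLinear {F : C ⥤ D} {G : D ⥤ C} (adj : F ⊣ G) [F.Additive] [F.Linear k] (X : C) (Y : D) :
    (F.obj X ⟶ Y) →ₗ[k] (X ⟶ G.obj Y) where
  toFun f := adj.homEquiv X Y f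
  map_add' f g := adj.homAddEquiv_add X Y f g
  map_smul' r f := homEquiv_smul k adj r f

@[simp]
theorem homLinear_apply {F : C ⥤ D} {G : D ⥤ C} (adj : F ⊣ G) [F.Additive] [F.Linear k] (X : C)
    (Y : D) (f : F.obj X ⟶ Y) : homLinear k adj X Y f = adj.homEquiv X Y f := rfl

variable [HasNakayama k D]
variable {G : C ⥤ D} {G₁ : D ⥤ C} {G₂ : C ⥤ D} {G₃ : D ⥤ C}
variable (adj₁ : G ⊣ G₁) (adj₂ : G₁ ⊣ G₂) (adj₃ : G₂ ⊣ G₃)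
variable [G.Additive] [G.Linear k]

/-- The composite of the maps
`Hom(M, X)^* → Hom(M, G₁ G₂ X)^* ≅ Hom(G M, G₂ X)^*`
(given by the counit of `G₁ ⊣ G₂` and the adjunction `G ⊣ G₁`) and the coprojection
`Hom(G M, G₂ X)^* → Hom(G₂ X, Nak(G M))`.

These are the components, indexed by `X`, of the composite of the isomorphisms
`∫^{X ∈ C} Hom(M, X)^* ⊙ G₂ X ≅ ∫^{Y ∈ D} Hom(M, G₁ Y)^* ⊙ Y ≅ ∫^{Y ∈ D} Hom(G M, Y)^* ⊙ Y`. -/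
def canComponent (M X : C) :
    Module.Dual k (M ⟶ X) →ₗ[k] (G₂.obj X ⟶ (nakayama k D).obj (G.obj M)) :=
  (nakι k (G.obj M) (G₂.obj X)).comp
    ((homLinear k adj₁ M (G₂.obj X)).dualMap.comp (dualPost k M (adj₂.counit.app X)))

theorem canComponent_dinatural (M : C) {X Y : C} (f : X ⟶ Y) (φ : Module.Dual k (M ⟶ Y)) :
    canComponent k adj₁ adj₂ M X (dualPost k M f φ) =
      G₂.map f ≫ canComponent k adj₁ adj₂ M Y φ := by
  simp only [canComponent, LinearMap.comp_apply]
  rw [← nakι_dinatural]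
  congr 1
  ext g
  simp [Adjunction.homEquiv_naturality_right]

variable [HasNakayama k C]

/-- The canonical morphism `G₂ (Nak M) ⟶ Nak (G M)` for a chain of adjunctions
`G ⊣ G₁ ⊣ G₂ ⊣ G₃`. As `G₂` is a left adjoint, it preserves the copowers and the coend defining
`Nak M`; the morphism below is the one whose restriction along the coprojections
of `G₂ (Nak M) ≅ ∫^X Hom(M, X)^* ⊙ G₂ X` is `canComponent` (see `nakι_can` and `can_unique`). -/
def canApp (M : C) : G₂.obj ((nakayama k C).obj M) ⟶ (nakayama k D).obj (G.obj M) :=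
  haveI : G₁.Linear k := rightAdjoint_linear k adj₁
  haveI : G₂.Linear k := rightAdjoint_linear k adj₂
  haveI : G₁.Additive := adj₁.right_adjoint_additive
  haveI : G₂.Additive := adj₂.right_adjoint_additive
  (adj₃.homEquiv _ _).symm
    (nakDesc k (fun X => (homLinear k adj₃ X _).comp (canComponent k adj₁ adj₂ M X))
      (fun X Y f φ => by
        simp only [LinearMap.comp_apply, homLinear_apply]
        rw [canComponent_dinatural, Adjunction.homEquiv_naturality_left]))

theorem nakι_can (M X : C) (φ : Module.Dual k (M ⟶ X)) :
    G₂.map (nakι k M X φ) ≫ canApp k adj₁ adj₂ adj₃ M = canComponent k adj₁ adj₂ M X φ := by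
  rw [canApp, ← Adjunction.homEquiv_naturality_left_symm, nakι_desc]
  simp

theorem can_unique (M : C) (f : G₂.obj ((nakayama k C).obj M) ⟶ (nakayama k D).obj (G.obj M))
    (h : ∀ (X : C) (φ : Module.Dual k (M ⟶ X)),
      G₂.map (nakι k M X φ) ≫ f = canComponent k adj₁ adj₂ M X φ) :
    f = canApp k adj₁ adj₂ adj₃ M :=
  map_nak_hom_ext k adj₃ (fun X φ => by rw [h, nakι_can])

/-- The canonical morphism `can_G : G₂ Nak ⟶ Nak G` as a natural transformation. -/
def can : nakayama k C ⋙ G₂ ⟶ G ⋙ nakayama k D where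
  app M := canApp k adj₁ adj₂ adj₃ M
  naturality M N f := by
    refine map_nak_hom_ext k adj₃ (fun X φ => ?_)
    dsimp
    rw [← Category.assoc, ← Category.assoc, ← G₂.map_comp, nakι_map, nakι_can, nakι_can]
    simp only [canComponent, LinearMap.comp_apply]
    rw [nakι_map]
    congr 1
    ext g
    simp [Adjunction.homEquiv_naturality_left]

end Canonical

/-! ## The monad `T^ll` and the bimodule `T^l` -/

section DoubleAdjoint

variable {C : Type w} [Category.{v} C]

section Comonad

variable (T : Monad C) {L : C ⥤ C} (adj : L ⊣ T.toFunctor)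

/-- The conjugate `L ⟶ 𝟭` of the unit `𝟭 ⟶ T`. -/
def conjε : L ⟶ 𝟭 C := (conjugateEquiv Adjunction.id adj).symm T.η

/-- The conjugate `L ⟶ L L` of the multiplication `T T ⟶ T`. -/
def conjδ : L ⟶ L ⋙ L := (conjugateEquiv (adj.comp adj) adj).symm T.μ

/-- The component `L X ⟶ X` of `conjε`. -/
abbrev conjεApp (X : C) : L.obj X ⟶ X := (conjε T adj).app X

/-- The component `L X ⟶ L (L X)` of `conjδ`. -/
abbrev conjδApp (X : C) : L.obj X ⟶ L.obj (L.obj X) := (conjδ T adj).app X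

theorem unit_conjε (X : C) : adj.unit.app X ≫ T.map (conjεApp T adj X) = T.η.app X := by
  have h := unit_conjugateEquiv_symm Adjunction.id adj T.η X
  exact h.symm.trans (by simp)

theorem unit_conjδ (X : C) :
    adj.unit.app X ≫ T.map (conjδApp T adj X) =
      adj.unit.app X ≫ T.map (adj.unit.app (L.obj X)) ≫ T.μ.app (L.obj (L.obj X)) := by
  have h := unit_conjugateEquiv_symm (adj.comp adj) adj T.μ X
  exact h.symm.trans (by simp)

theorem conjε_nat {X Y : C} (f : X ⟶ Y) : L.map f ≫ conjεApp T adj Y = conjεApp T adj X ≫ f :=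
  (conjε T adj).naturality f

theorem conjδ_nat {X Y : C} (f : X ⟶ Y) :
    L.map f ≫ conjδApp T adj Y = conjδApp T adj X ≫ L.map (L.map f) :=
  (conjδ T adj).naturality f

theorem conjε_counit (X : C) :
    L.map (T.η.app X) ≫ adj.counit.app X = conjεApp T adj X := by
  have h := conjugateEquiv_counit_symm Adjunction.id adj T.η X
  exact h.trans (Category.comp_id _)

theorem conjδ_counit (X : C) :
    L.map (T.μ.app X) ≫ adj.counit.app X =
      conjδApp T adj (T.obj (T.obj X)) ≫ L.map (adj.counit.app (T.obj X)) ≫ adj.counit.app X := by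
  have h := conjugateEquiv_counit_symm (adj.comp adj) adj T.μ X
  rw [Adjunction.comp_counit_app] at h
  exact h

theorem unit_conjε_comp {X Y : C} (g : X ⟶ Y) :
    adj.unit.app X ≫ T.map (conjεApp T adj X ≫ g) = T.η.app X ≫ T.map g := by
  rw [T.map_comp, ← Category.assoc, unit_conjε]

theorem unit_conjδ_comp {X Y : C} (g : L.obj (L.obj X) ⟶ Y) :
    adj.unit.app X ≫ T.map (conjδApp T adj X ≫ g) =
      adj.unit.app X ≫ T.map (adj.unit.app (L.obj X) ≫ T.map g) ≫ T.μ.app Y := by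
  rw [T.map_comp, ← Category.assoc, unit_conjδ, T.map_comp]
  simp only [Category.assoc, T.mu_naturality]

theorem conj_coassoc (X : C) :
    conjδApp T adj X ≫ L.map (conjδApp T adj X) =
      conjδApp T adj X ≫ conjδApp T adj (L.obj X) := by
  apply (adj.homEquiv _ _).injective
  rw [Adjunction.homEquiv_unit, Adjunction.homEquiv_unit, unit_conjδ_comp, unit_conjδ_comp,
    adj.unit_naturality, unit_conjδ, ← Category.assoc, unit_conjδ_comp]
  simp only [T.map_comp, Category.assoc, T.assoc]

theorem conj_left_counit (X : C) :
    conjδApp T adj X ≫ conjεApp T adj (L.obj X) = 𝟙 (L.obj X) := by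
  apply (adj.homEquiv _ _).injective
  rw [Adjunction.homEquiv_unit, Adjunction.homEquiv_unit, unit_conjδ_comp, unit_conjε,
    T.right_unit, T.map_id]
  rfl

theorem conj_right_counit (X : C) :
    conjδApp T adj X ≫ L.map (conjεApp T adj X) = 𝟙 (L.obj X) := by
  apply (adj.homEquiv _ _).injective
  rw [Adjunction.homEquiv_unit, Adjunction.homEquiv_unit, unit_conjδ_comp,
    adj.unit_naturality, ← Category.assoc, unit_conjε_comp, ← T.unit_naturality, Category.assoc,
    T.left_unit, T.map_id]
  rfl

/-- A left adjoint of (the underlying functor of) a monad is a comonad, the structure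
morphisms being the conjugates of those of the monad. -/
abbrev leftAdjointComonad : Comonad C where
  toFunctor := L
  ε := conjε T adj
  δ := conjδ T adj
  coassoc X := conj_coassoc T adj X
  left_counit X := conj_left_counit T adj X
  right_counit X := conj_right_counit T adj X

end Comonad

section Monad

variable (U : Comonad C) {L : C ⥤ C} (adj : L ⊣ U.toFunctor)

/-- The conjugate `𝟭 ⟶ L` of the counit `U ⟶ 𝟭`. -/
def conjη : 𝟭 C ⟶ L := (conjugateEquiv adj Adjunction.id).symm U.ε

/-- The conjugate `L L ⟶ L` of the comultiplication `U ⟶ U U`. -/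
def conjμ : L ⋙ L ⟶ L := (conjugateEquiv adj (adj.comp adj)).symm U.δ

/-- The component `X ⟶ L X` of `conjη`. -/
abbrev conjηApp (X : C) : X ⟶ L.obj X := (conjη U adj).app X

/-- The component `L (L X) ⟶ L X` of `conjμ`. -/
abbrev conjμApp (X : C) : L.obj (L.obj X) ⟶ L.obj X := (conjμ U adj).app X

theorem conjη_eq (X : C) : conjηApp U adj X = adj.unit.app X ≫ U.ε.app (L.obj X) := by
  have h := unit_conjugateEquiv_symm adj Adjunction.id U.ε X
  exact (h.trans (Category.id_comp _)).symm

theorem unit_conjμ (X : C) :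
    adj.unit.app X ≫ U.map (adj.unit.app (L.obj X) ≫ U.map (conjμApp U adj X)) =
      adj.unit.app X ≫ U.δ.app (L.obj X) := by
  have h := unit_conjugateEquiv_symm adj (adj.comp adj) U.δ X
  rw [Adjunction.comp_unit_app] at h
  rw [U.map_comp, ← Category.assoc]
  exact h.symm

/-- The morphism `L Q ⟶ Q` corresponding to `ρ : Q ⟶ U Q`. -/
abbrev transposed {Q : C} (ρ : Q ⟶ U.obj Q) : L.obj Q ⟶ Q := (adj.homEquiv Q Q).symm ρ

theorem unit_transposed {Q : C} (ρ : Q ⟶ U.obj Q) :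
    adj.unit.app Q ≫ U.map (transposed U adj ρ) = ρ := by
  exact (adj.homEquiv_unit Q Q _).symm.trans (Equiv.apply_symm_apply _ _)

theorem conjη_transposed {Q : C} (ρ : Q ⟶ U.obj Q) :
    conjηApp U adj Q ≫ transposed U adj ρ = ρ ≫ U.ε.app Q := by
  rw [conjη_eq, Category.assoc, ← U.counit_naturality, ← Category.assoc, unit_transposed]

theorem conjμ_transposed_iff {Q : C} (ρ : Q ⟶ U.obj Q) :
    conjμApp U adj Q ≫ transposed U adj ρ = L.map (transposed U adj ρ) ≫ transposed U adj ρ ↔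
      ρ ≫ U.δ.app Q = ρ ≫ U.map ρ := by
  have e1 : adj.unit.app Q ≫ U.map (transposed U adj ρ ≫ ρ) = ρ ≫ U.map ρ := by
    rw [U.map_comp, ← Category.assoc, unit_transposed]
  have e2 : adj.unit.app Q ≫ U.map (adj.unit.app (L.obj Q) ≫
      U.map (conjμApp U adj Q ≫ transposed U adj ρ)) = ρ ≫ U.δ.app Q := by
    rw [U.map_comp (conjμApp U adj Q), ← Category.assoc (adj.unit.app (L.obj Q)), U.map_comp,
      ← Category.assoc, unit_conjμ, Category.assoc, ← U.delta_naturality, ← Category.assoc,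
      unit_transposed]
  rw [← (adj.homEquiv _ _).injective.eq_iff, Adjunction.homEquiv_naturality_left,
    Equiv.apply_symm_apply, Adjunction.homEquiv_unit, ← (adj.homEquiv _ _).injective.eq_iff,
    Adjunction.homEquiv_unit, Adjunction.homEquiv_unit, e1, e2]

theorem conjμ_transposed {Q : C} (ρ : Q ⟶ U.obj Q) (h : ρ ≫ U.δ.app Q = ρ ≫ U.map ρ) :
    conjμApp U adj Q ≫ transposed U adj ρ =
      L.map (transposed U adj ρ) ≫ transposed U adj ρ :=
  (conjμ_transposed_iff U adj ρ).2 h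

theorem transposed_conjμ (X : C) :
    transposed U adj (Q := L.obj X) (adj.unit.app (L.obj X) ≫ U.map (conjμApp U adj X)) =
      conjμApp U adj X := by
  apply (adj.homEquiv _ _).injective
  rw [Equiv.apply_symm_apply, Adjunction.homEquiv_unit]

theorem conj_coaction (X : C) :
    (adj.unit.app (L.obj X) ≫ U.map (conjμApp U adj X)) ≫ U.δ.app (L.obj X) =
      (adj.unit.app (L.obj X) ≫ U.map (conjμApp U adj X)) ≫
        U.map (adj.unit.app (L.obj X) ≫ U.map (conjμApp U adj X)) := by
  have h := unit_conjμ U adj X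
  set a := adj.unit.app (L.obj X) ≫ U.map (conjμApp U adj X) with ha
  apply (adj.homEquiv _ _).injective
  have e1 : adj.unit.app X ≫ U.map (a ≫ U.δ.app (L.obj X)) =
      adj.unit.app X ≫ U.δ.app (L.obj X) ≫ U.map (U.δ.app (L.obj X)) := by
    rw [U.map_comp, ← Category.assoc, h, Category.assoc]
  have e2 : adj.unit.app X ≫ U.map (a ≫ U.map a) =
      adj.unit.app X ≫ U.δ.app (L.obj X) ≫ U.δ.app (U.obj (L.obj X)) := by
    rw [U.map_comp, ← Category.assoc, h, Category.assoc, ← U.delta_naturality, ← Category.assoc,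
      h, Category.assoc]
  rw [Adjunction.homEquiv_unit, Adjunction.homEquiv_unit, e1, e2, U.coassoc]

theorem conj_assoc (X : C) :
    L.map (conjμApp U adj X) ≫ conjμApp U adj X =
      conjμApp U adj (L.obj X) ≫ conjμApp U adj X := by
  have h := conjμ_transposed U adj (Q := L.obj X) _ (conj_coaction U adj X)
  rw [transposed_conjμ] at h
  exact h.symm

theorem conj_left_unit (X : C) :
    conjηApp U adj (L.obj X) ≫ conjμApp U adj X = 𝟙 (L.obj X) := by
  have h := conjη_transposed U adj (Q := L.obj X) (adj.unit.app (L.obj X) ≫ U.map (conjμApp U adj X))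
  rw [transposed_conjμ] at h
  rw [h]
  apply (adj.homEquiv _ _).injective
  rw [Adjunction.homEquiv_unit, Adjunction.homEquiv_unit, U.map_comp, ← Category.assoc,
    unit_conjμ, Category.assoc, U.right_counit, U.map_id]

theorem conj_right_unit (X : C) :
    L.map (conjηApp U adj X) ≫ conjμApp U adj X = 𝟙 (L.obj X) := by
  apply (adj.homEquiv _ _).injective
  rw [Adjunction.homEquiv_naturality_left, Adjunction.homEquiv_unit, Adjunction.homEquiv_unit,
    conjη_eq, Category.assoc, ← U.counit_naturality, ← Category.assoc, unit_conjμ,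
    Category.assoc, U.left_counit, U.map_id]

/-- A left adjoint of (the underlying functor of) a comonad is a monad, the structure
morphisms being the conjugates of those of the comonad. -/
abbrev leftAdjointMonad : Monad C where
  toFunctor := L
  η := conjη U adj
  μ := conjμ U adj
  assoc X := conj_assoc U adj X
  left_unit X := conj_left_unit U adj X
  right_unit X := conj_right_unit U adj X

end Monad

section Bimodule

variable (T : Monad C) {Tl Tll : C ⥤ C} (adj₁ : Tl ⊣ T.toFunctor) (adj₂ : Tll ⊣ Tl)

/-- The monad `T^ll` whose structure morphisms are the twofold conjugates of those of `T`. -/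
abbrev doubleLeftAdjoint : Monad C := leftAdjointMonad (leftAdjointComonad T adj₁) adj₂

/-- The component `T^l (T M) ⟶ T^l M` of the right `T`-action `T^l T ⟶ T^l`: the action
corresponds, under `T^l ⊣ T`, to the composite `T ⟶ T T T^l ⟶ T T^l` of the unit of `T^l ⊣ T`
and the multiplication of `T`. -/
def rightActApp (M : C) : Tl.obj (T.obj M) ⟶ Tl.obj M :=
  (adj₁.homEquiv _ _).symm (T.map (adj₁.unit.app M) ≫ T.μ.app (Tl.obj M))

theorem rightAct_nat {M N : C} (f : M ⟶ N) :
    Tl.map (T.map f) ≫ rightActApp T adj₁ N = rightActApp T adj₁ M ≫ Tl.map f := by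
  rw [rightActApp, rightActApp, ← Adjunction.homEquiv_naturality_left_symm,
    ← Adjunction.homEquiv_naturality_right_symm]
  congr 1
  rw [Category.assoc, ← T.mu_naturality, ← Category.assoc, ← Category.assoc, ← T.map_comp,
    ← T.map_comp, adj₁.unit_naturality]

/-- The right `T`-action `T^l T ⟶ T^l`. -/
def rightAct : T.toFunctor ⋙ Tl ⟶ Tl where
  app M := rightActApp T adj₁ M
  naturality _ _ f := rightAct_nat T adj₁ f

/-- The left `T^ll`-action `T^ll T^l ⟶ T^l`: it corresponds, under `T^ll ⊣ T^l`, to the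
conjugate `T^l ⟶ T^l T^l` of the multiplication of `T`. -/
def leftAct : Tl ⋙ Tll ⟶ Tl where
  app M := (adj₂.homEquiv _ _).symm (conjδApp T adj₁ M)
  naturality M N f := by
    dsimp
    rw [← Adjunction.homEquiv_naturality_left_symm, ← Adjunction.homEquiv_naturality_right_symm,
      conjδ_nat]

/-- The left and right actions on `T^l` commute; stated in terms of `T^l ⟶ T^l T^l`. -/
theorem rightAct_conjδ (M : C) :
    rightActApp T adj₁ M ≫ conjδApp T adj₁ M =
      conjδApp T adj₁ (T.obj M) ≫ Tl.map (rightActApp T adj₁ M) := by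
  have hb : adj₁.homEquiv _ _ (rightActApp T adj₁ M) =
      T.map (adj₁.unit.app M) ≫ T.μ.app (Tl.obj M) := Equiv.apply_symm_apply _ _
  have hb' : adj₁.unit.app (T.obj M) ≫ T.map (rightActApp T adj₁ M) =
      T.map (adj₁.unit.app M) ≫ T.μ.app (Tl.obj M) := by
    rw [← hb, Adjunction.homEquiv_unit]
  apply (adj₁.homEquiv _ _).injective
  have e1 : adj₁.unit.app (T.obj M) ≫ T.map (rightActApp T adj₁ M ≫ conjδApp T adj₁ M) =
      T.map (adj₁.unit.app M) ≫ T.map (T.map (adj₁.unit.app (Tl.obj M))) ≫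
        T.μ.app _ ≫ T.μ.app _ := by
    rw [T.map_comp, ← Category.assoc, hb', Category.assoc, ← T.mu_naturality, ← Category.assoc,
      ← T.map_comp, unit_conjδ]
    simp only [T.map_comp, Category.assoc, T.assoc]
    rfl
  have e2 : adj₁.unit.app (T.obj M) ≫ T.map (conjδApp T adj₁ (T.obj M) ≫
      Tl.map (rightActApp T adj₁ M)) =
      T.map (adj₁.unit.app M) ≫ T.map (T.map (adj₁.unit.app (Tl.obj M))) ≫
        T.μ.app _ ≫ T.μ.app _ := by
    have h := unit_conjδ_comp T adj₁ (Tl.map (rightActApp T adj₁ M))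
    refine h.trans ?_
    rw [adj₁.unit_naturality, T.map_comp, Category.assoc, ← Category.assoc, hb', Category.assoc, ← Category.assoc (T.μ.app _), ← T.mu_naturality, Category.assoc]
    rfl
  exact (adj₁.homEquiv_unit _ _ _).trans ((e1.trans e2.symm).trans
    (adj₁.homEquiv_unit _ _ _).symm)

/-- The morphism `M ⟶ T^l M` corresponding to the action `T^ll M ⟶ M`. -/
abbrev coact (M : (doubleLeftAdjoint T adj₁ adj₂).Algebra) : M.A ⟶ Tl.obj M.A :=
  adj₂.homEquiv M.A M.A M.a

theorem coact_counit (M : (doubleLeftAdjoint T adj₁ adj₂).Algebra) :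
    coact T adj₁ adj₂ M ≫ conjεApp T adj₁ M.A = 𝟙 M.A := by
  have h := conjη_transposed (leftAdjointComonad T adj₁) adj₂ (coact T adj₁ adj₂ M)
  rw [transposed, Equiv.symm_apply_apply] at h
  exact h.symm.trans M.unit

theorem coact_coassoc (M : (doubleLeftAdjoint T adj₁ adj₂).Algebra) :
    coact T adj₁ adj₂ M ≫ conjδApp T adj₁ M.A =
      coact T adj₁ adj₂ M ≫ Tl.map (coact T adj₁ adj₂ M) := by
  refine (conjμ_transposed_iff (leftAdjointComonad T adj₁) adj₂ (coact T adj₁ adj₂ M)).1 ?_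
  rw [transposed, Equiv.symm_apply_apply]
  exact M.assoc

end Bimodule

section Tensor

variable [HasCoequalizers C]
variable (T : Monad C) {Tl Tll : C ⥤ C} (adj₁ : Tl ⊣ T.toFunctor) (adj₂ : Tll ⊣ Tl)

/-- The tensor product `T^l ⊗_T M`, the coequalizer of the right action
`b_M : T^l (T M) ⟶ T^l M` and `T^l (a_M)`. -/
def tensorObj (M : T.Algebra) : C :=
  coequalizer (rightActApp T adj₁ M.A) (Tl.map M.a)

/-- The canonical epimorphism `T^l M ⟶ T^l ⊗_T M`. -/
def tensorπ (M : T.Algebra) : Tl.obj M.A ⟶ tensorObj T adj₁ M :=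
  coequalizer.π _ _

theorem tensorπ_condition (M : T.Algebra) :
    rightActApp T adj₁ M.A ≫ tensorπ T adj₁ M =
      Tl.map M.a ≫ tensorπ T adj₁ M :=
  coequalizer.condition _ _

/-- The universal property of `T^l ⊗_T M`. -/
def tensorDesc (M : T.Algebra) {Y : C} (f : Tl.obj M.A ⟶ Y)
    (h : rightActApp T adj₁ M.A ≫ f = Tl.map M.a ≫ f) :
    tensorObj T adj₁ M ⟶ Y :=
  coequalizer.desc f h

theorem tensorπ_desc (M : T.Algebra) {Y : C} (f : Tl.obj M.A ⟶ Y)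
    (h : rightActApp T adj₁ M.A ≫ f = Tl.map M.a ≫ f) :
    tensorπ T adj₁ M ≫ tensorDesc T adj₁ M f h = f :=
  coequalizer.π_desc f h

theorem tensor_hom_ext (M : T.Algebra) {Y : C} {f g : tensorObj T adj₁ M ⟶ Y}
    (h : tensorπ T adj₁ M ≫ f = tensorπ T adj₁ M ≫ g) : f = g :=
  coequalizer.hom_ext h

/-- The morphism `T^l ⊗_T M ⟶ T^l (T^l ⊗_T M)` induced by `T^l ⟶ T^l T^l`. -/
def tensorCoact (M : T.Algebra) : tensorObj T adj₁ M ⟶ Tl.obj (tensorObj T adj₁ M) :=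
  tensorDesc T adj₁ M (conjδApp T adj₁ M.A ≫ Tl.map (tensorπ T adj₁ M)) (by
    have h := rightAct_conjδ T adj₁ M.A
    rw [← Category.assoc, ← Category.assoc, conjδ_nat]
    refine (congrArg (· ≫ Tl.map (tensorπ T adj₁ M)) h).trans ?_
    simp only [Category.assoc, ← Tl.map_comp, tensorπ_condition])

theorem tensorπ_coact (M : T.Algebra) :
    tensorπ T adj₁ M ≫ tensorCoact T adj₁ M =
      conjδApp T adj₁ M.A ≫ Tl.map (tensorπ T adj₁ M) :=
  tensorπ_desc _ _ _ _ _

theorem tensorCoact_counit (M : T.Algebra) :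
    tensorCoact T adj₁ M ≫ conjεApp T adj₁ (tensorObj T adj₁ M) = 𝟙 _ := by
  apply tensor_hom_ext
  rw [← Category.assoc, tensorπ_coact, Category.assoc, conjε_nat, ← Category.assoc,
    conj_left_counit, Category.id_comp, Category.comp_id]

theorem tensorCoact_coassoc (M : T.Algebra) :
    tensorCoact T adj₁ M ≫ conjδApp T adj₁ (tensorObj T adj₁ M) =
      tensorCoact T adj₁ M ≫ Tl.map (tensorCoact T adj₁ M) := by
  apply tensor_hom_ext
  rw [← Category.assoc, ← Category.assoc, tensorπ_coact, Category.assoc, Category.assoc,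
    conjδ_nat, ← Tl.map_comp, tensorπ_coact, Tl.map_comp, ← Category.assoc, ← Category.assoc,
    conj_coassoc]

/-- The action of `T^ll` on `T^l ⊗_T M`; by `tensorπ_act` it is induced by the left action
`T^ll T^l ⟶ T^l`. -/
def tensorAct (M : T.Algebra) : Tll.obj (tensorObj T adj₁ M) ⟶ tensorObj T adj₁ M :=
  (adj₂.homEquiv _ _).symm (tensorCoact T adj₁ M)

theorem tensorπ_act (M : T.Algebra) :
    Tll.map (tensorπ T adj₁ M) ≫ tensorAct T adj₁ adj₂ M =
      (leftAct T adj₁ adj₂).app M.A ≫ tensorπ T adj₁ M := by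
  simp only [tensorAct, leftAct]
  rw [← Adjunction.homEquiv_naturality_left_symm, ← Adjunction.homEquiv_naturality_right_symm,
    tensorπ_coact]

/-- The `T^ll`-module `T^l ⊗_T M`. -/
abbrev tensorAlgebra (M : T.Algebra) : (doubleLeftAdjoint T adj₁ adj₂).Algebra where
  A := tensorObj T adj₁ M
  a := tensorAct T adj₁ adj₂ M
  unit := (conjη_transposed (leftAdjointComonad T adj₁) adj₂ (tensorCoact T adj₁ M)).trans
    (tensorCoact_counit T adj₁ M)
  assoc := conjμ_transposed (leftAdjointComonad T adj₁) adj₂ (tensorCoact T adj₁ M)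
    (tensorCoact_coassoc T adj₁ M)

/-- The morphism `T^l ⊗_T M ⟶ T^l ⊗_T N` induced by a morphism of `T`-modules. -/
def tensorMap {M N : T.Algebra} (f : M ⟶ N) : tensorObj T adj₁ M ⟶ tensorObj T adj₁ N :=
  tensorDesc T adj₁ M (Tl.map f.f ≫ tensorπ T adj₁ N) (by
    rw [← Category.assoc, ← rightAct_nat, Category.assoc, tensorπ_condition, ← Category.assoc,
      ← Category.assoc, ← Tl.map_comp, ← Tl.map_comp, f.h])

theorem tensorπ_map {M N : T.Algebra} (f : M ⟶ N) :
    tensorπ T adj₁ M ≫ tensorMap T adj₁ f = Tl.map f.f ≫ tensorπ T adj₁ N :=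
  tensorπ_desc _ _ _ _ _

theorem tensorMap_coact {M N : T.Algebra} (f : M ⟶ N) :
    tensorMap T adj₁ f ≫ tensorCoact T adj₁ N =
      tensorCoact T adj₁ M ≫ Tl.map (tensorMap T adj₁ f) := by
  apply tensor_hom_ext
  rw [← Category.assoc, ← Category.assoc, tensorπ_map, tensorπ_coact, Category.assoc,
    Category.assoc, tensorπ_coact, ← Tl.map_comp, tensorπ_map, Tl.map_comp, ← Category.assoc,
    ← Category.assoc, conjδ_nat]

theorem tensorMap_act {M N : T.Algebra} (f : M ⟶ N) :
    Tll.map (tensorMap T adj₁ f) ≫ tensorAct T adj₁ adj₂ N =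
      tensorAct T adj₁ adj₂ M ≫ tensorMap T adj₁ f := by
  rw [tensorAct, tensorAct, ← Adjunction.homEquiv_naturality_left_symm,
    ← Adjunction.homEquiv_naturality_right_symm, tensorMap_coact]

/-- The functor `T^l ⊗_T (-)` from `T`-modules to `T^ll`-modules. -/
def tensor : T.Algebra ⥤ (doubleLeftAdjoint T adj₁ adj₂).Algebra where
  obj M := tensorAlgebra T adj₁ adj₂ M
  map f :=
    { f := tensorMap T adj₁ f
      h := tensorMap_act T adj₁ adj₂ f }
  map_id M := Monad.Algebra.Hom.ext (tensor_hom_ext T adj₁ M (by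
    refine (tensorπ_map T adj₁ (𝟙 M)).trans ?_
    simp))
  map_comp {M N P} f g := Monad.Algebra.Hom.ext (tensor_hom_ext T adj₁ M (by
    have h : tensorπ T adj₁ M ≫ tensorMap T adj₁ f ≫ tensorMap T adj₁ g =
        Tl.map (f.f ≫ g.f) ≫ tensorπ T adj₁ P := by
      rw [← Category.assoc, tensorπ_map, Category.assoc, tensorπ_map, Tl.map_comp,
        Category.assoc]
    exact (tensorπ_map T adj₁ (f ≫ g)).trans h.symm))

end Tensor

end DoubleAdjoint

/-! ## The lift of the Nakayama functor -/

section Lift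

variable (k : Type u) [Field k] {C : Type w} [Category.{v} C] [Preadditive C] [Linear k C]
variable (T : Monad C) [T.toFunctor.Additive] [T.toFunctor.Linear k]
variable {Tl Tll Tr : C ⥤ C}
variable (adj₂ : Tll ⊣ Tl) (adj₁ : Tl ⊣ T.toFunctor) (adj₀ : T.toFunctor ⊣ Tr)

/-- The functional `g ↦ φ (M ⟶ T^l M ⟶ T^l T X ⟶ X)` on `Hom(M, T X)`. -/
def liftDual (M : (doubleLeftAdjoint T adj₁ adj₂).Algebra) (X : C)
    (φ : Module.Dual k (M.A ⟶ X)) : Module.Dual k (M.A ⟶ T.obj X) where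
  toFun g := φ (coact T adj₁ adj₂ M ≫ Tl.map g ≫ adj₁.counit.app X)
  map_add' f g := by
    have : Tl.Additive := adj₁.left_adjoint_additive
    rw [Tl.map_add, Preadditive.add_comp, Preadditive.comp_add, map_add]
  map_smul' r g := by
    have : Tl.Linear k := leftAdjoint_linear k adj₁
    rw [Tl.map_smul, Linear.smul_comp, Linear.comp_smul, map_smul]
    rfl

theorem liftDual_apply (M : (doubleLeftAdjoint T adj₁ adj₂).Algebra) (X : C)
    (φ : Module.Dual k (M.A ⟶ X)) (g : M.A ⟶ T.obj X) :
    liftDual k T adj₂ adj₁ M X φ g =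
      φ (coact T adj₁ adj₂ M ≫ Tl.map g ≫ adj₁.counit.app X) := rfl

variable [HasNakayama k C]

/-- The canonical morphism `can : T Nak ⟶ Nak T^ll`, for `T^ll ⊣ T^l ⊣ T ⊣ T^r`. -/
def canLL : nakayama k C ⋙ T.toFunctor ⟶ Tll ⋙ nakayama k C :=
  haveI : Tl.Additive := adj₁.left_adjoint_additive
  haveI : Tll.Additive := adj₂.left_adjoint_additive
  haveI : Tl.Linear k := leftAdjoint_linear k adj₁
  haveI : Tll.Linear k := leftAdjoint_linear k adj₂
  can k adj₂ adj₁ adj₀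

/-- The `T`-action `T (Nak M) ⟶ Nak (T^ll M) ⟶ Nak M` on `Nak M`, for a `T^ll`-module `M`. -/
def liftAct (M : (doubleLeftAdjoint T adj₁ adj₂).Algebra) :
    T.obj ((nakayama k C).obj M.A) ⟶ (nakayama k C).obj M.A :=
  (canLL k T adj₂ adj₁ adj₀).app M.A ≫ (nakayama k C).map M.a

/-- The action in terms of the coprojections `i_X : Hom(M, X)^* → Hom(X, Nak M)`. -/
theorem nakι_liftAct (M : (doubleLeftAdjoint T adj₁ adj₂).Algebra) (X : C)
    (φ : Module.Dual k (M.A ⟶ X)) :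
    T.map (nakι k M.A X φ) ≫ liftAct k T adj₂ adj₁ adj₀ M =
      nakι k M.A (T.obj X) (liftDual k T adj₂ adj₁ M X φ) := by
  have : Tl.Additive := adj₁.left_adjoint_additive
  have : Tll.Additive := adj₂.left_adjoint_additive
  have : Tl.Linear k := leftAdjoint_linear k adj₁
  have : Tll.Linear k := leftAdjoint_linear k adj₂
  have h1 := congrArg (· ≫ (nakayama k C).map M.a) (nakι_can k adj₂ adj₁ adj₀ M.A X φ)
  refine (Category.assoc _ _ _).symm.trans (h1.trans ?_)
  dsimp only [canComponent, LinearMap.comp_apply]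
  refine (nakι_map k M.a (T.obj X) _).trans ?_
  congr 1
  ext g
  rw [liftDual_apply, ← Category.assoc, ← Adjunction.homEquiv_naturality_right]
  simp

theorem liftAct_unit (M : (doubleLeftAdjoint T adj₁ adj₂).Algebra) :
    T.η.app ((nakayama k C).obj M.A) ≫ liftAct k T adj₂ adj₁ adj₀ M = 𝟙 _ := by
  refine nak_hom_ext k (fun X φ => ?_)
  have e : dualPost k M.A (X := X) (Y := T.obj X) (T.η.app X) (liftDual k T adj₂ adj₁ M X φ) = φ := by
    ext g
    simp only [LinearMap.dualMap_apply, Linear.rightComp_apply, liftDual_apply]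
    have h : coact T adj₁ adj₂ M ≫ Tl.map (g ≫ T.η.app X) ≫ adj₁.counit.app X = g := by
      rw [Tl.map_comp, Category.assoc, conjε_counit]
      refine (congrArg (coact T adj₁ adj₂ M ≫ ·) (conjε_nat T adj₁ g)).trans ?_
      refine (Category.assoc _ _ _).symm.trans ?_
      rw [coact_counit]
      exact Category.id_comp g
    exact congrArg φ h
  have h1 := nakι_dinatural k M.A (X := X) (Y := T.obj X) (T.η.app X)
    (liftDual k T adj₂ adj₁ M X φ)
  rw [e] at h1
  refine Eq.trans ?_ (Category.comp_id _).symm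
  refine (Category.assoc _ _ _).symm.trans ?_
  have h2 := congrArg (· ≫ liftAct k T adj₂ adj₁ adj₀ M) (T.η.naturality (nakι k M.A X φ))
  refine h2.trans ((Category.assoc _ _ _).trans ?_)
  rw [nakι_liftAct]
  exact h1.symm

theorem liftAct_assoc (M : (doubleLeftAdjoint T adj₁ adj₂).Algebra) :
    T.μ.app ((nakayama k C).obj M.A) ≫ liftAct k T adj₂ adj₁ adj₀ M =
      T.map (liftAct k T adj₂ adj₁ adj₀ M) ≫ liftAct k T adj₂ adj₁ adj₀ M := by
  refine map_nak_hom_ext k (adj₀.comp adj₀) (fun X φ => ?_)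
  have e : dualPost k M.A (X := T.obj (T.obj X)) (Y := T.obj X) (T.μ.app X) (liftDual k T adj₂ adj₁ M X φ) =
      liftDual k T adj₂ adj₁ M (T.obj X) (liftDual k T adj₂ adj₁ M X φ) := by
    ext g
    simp only [LinearMap.dualMap_apply, Linear.rightComp_apply, liftDual_apply]
    have h : coact T adj₁ adj₂ M ≫ Tl.map (g ≫ T.μ.app X) ≫ adj₁.counit.app X =
        coact T adj₁ adj₂ M ≫ Tl.map (coact T adj₁ adj₂ M ≫ Tl.map g ≫
          adj₁.counit.app (T.obj X)) ≫ adj₁.counit.app X := by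
      rw [Tl.map_comp, Category.assoc, conjδ_counit]
      rw [← Category.assoc (Tl.map g), conjδ_nat, Tl.map_comp, Tl.map_comp]
      simp only [Category.assoc]
      rw [← Category.assoc, coact_coassoc, Category.assoc]
    exact congrArg φ h
  have h1 := nakι_dinatural k M.A (X := T.obj (T.obj X)) (Y := T.obj X) (T.μ.app X)
    (liftDual k T adj₂ adj₁ M X φ)
  rw [e] at h1
  have h2 := congrArg (· ≫ liftAct k T adj₂ adj₁ adj₀ M) (T.μ.naturality (nakι k M.A X φ))
  have h3 := congrArg T.map (nakι_liftAct k T adj₂ adj₁ adj₀ M X φ)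
  rw [T.map_comp] at h3
  have h4 := congrArg (· ≫ liftAct k T adj₂ adj₁ adj₀ M) h3
  refine ((Category.assoc _ _ _).symm.trans (h2.trans (Category.assoc _ _ _))).trans ?_
  refine Eq.trans ?_ (h4.symm.trans (Category.assoc _ _ _))
  rw [nakι_liftAct, nakι_liftAct]
  exact h1.symm

theorem liftAct_nat {M N : (doubleLeftAdjoint T adj₁ adj₂).Algebra} (f : M ⟶ N) :
    T.map ((nakayama k C).map f.f) ≫ liftAct k T adj₂ adj₁ adj₀ N =
      liftAct k T adj₂ adj₁ adj₀ M ≫ (nakayama k C).map f.f := by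
  have h1 := congrArg (· ≫ (nakayama k C).map N.a) ((canLL k T adj₂ adj₁ adj₀).naturality f.f)
  refine (Category.assoc _ _ _).symm.trans (h1.trans ?_)
  have h2 := congrArg (nakayama k C).map f.h
  rw [Functor.map_comp, Functor.map_comp] at h2
  refine (Category.assoc _ _ _).trans (Eq.trans ?_ (Category.assoc _ _ _).symm)
  exact congrArg ((canLL k T adj₂ adj₁ adj₀).app M.A ≫ ·) h2

/-- The lift of the Nakayama functor of `C` to a functor from `T^ll`-modules to `T`-modules. -/
def nakayamaLift : (doubleLeftAdjoint T adj₁ adj₂).Algebra ⥤ T.Algebra where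
  obj M :=
    { A := (nakayama k C).obj M.A
      a := liftAct k T adj₂ adj₁ adj₀ M
      unit := liftAct_unit k T adj₂ adj₁ adj₀ M
      assoc := liftAct_assoc k T adj₂ adj₁ adj₀ M }
  map f :=
    { f := (nakayama k C).map f.f
      h := liftAct_nat k T adj₂ adj₁ adj₀ f }
  map_id M := Monad.Algebra.Hom.ext ((nakayama k C).map_id M.A)
  map_comp f g := Monad.Algebra.Hom.ext ((nakayama k C).map_comp f.f g.f)

end Lift

end NakMonad

end

/-! The value of a Nakayama functor at `M` is pinned down by its universal dinatural family of
linear maps `Hom(M, X)^* → Hom(X, N)`. It therefore suffices to put such a family, natural in `M`,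
on the values of the composite functor on `T`-modules and to prove it universal; this gives
existence and the isomorphism at once.

The key fact is that `T^l ⊗_T (-)` is left adjoint to the free module functor: under `T^l ⊣ T`, a
morphism out of `T^l M` into `Z` coequalizes `b_M` and `T^l(a_M)` exactly when its transpose `M ⟶ T
Z` is `T`-linear. Hence `Hom(T^l ⊗_T M, Z) ≅ Hom_T(M, T Z)` (`tensorFreeEquiv`), while `Hom_T(T Z,
Y) ≅ Hom(Z, Y)`. Restricting a dinatural family from `M` to `Y` over `T`-modules to free modules
thus yields a dinatural family from `T^l ⊗_T M` to the underlying object of `Y`. Nothing is lost: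
dinaturality along the action `T X ⟶ X`, followed by the unit law, recovers the component at any
module `X`. So the underlying object of the coend over `T`-modules is `Nak(T^l ⊗_T M)`.

The remaining question is whether its action is the one prescribed through `can`. This reduces to
`liftDual_eq_tensorDual`: the coaction of `T^l ⊗_T M` comes from the conjugate of `μ`, so it becomes
`μ` after transposition (`tensorFreeEquiv_coact`).

Existence for the base category uses an object `P` with `Hom(P, -)` fully faithful into
`End(P)`-modules, namely one corresponding to the regular module. The coend is then `Hom(M, P)^*
⊗_{End P} P`, a coequalizer of finite copowers. -/

noncomputable section

namespace NakMonad

/-! ### Copowers by finite-dimensional vector spaces. -/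

section Copower

variable (k : Type u) [Field k] {C : Type w} [Category.{v} C] [Preadditive C] [Linear k C]

/-- A basis of `V` turns the copower into a finite direct sum of copies of `X`. -/
theorem hasCopower_of_finite [HasFiniteBiproducts C] (V : Type v') [AddCommGroup V] [Module k V]
    [Module.Finite k V] (X : C) : HasCopower k V X where
  exists_isCopower := by
    let b := Module.finBasis k V
    let F : Fin (Module.finrank k V) → C := fun _ => X
    refine ⟨⨁ F, b.constr k (fun j => biproduct.ι F j), fun Y g => ?_⟩
    have key (f : ⨁ F ⟶ Y) : (∀ x, b.constr k (fun j => biproduct.ι F j) x ≫ f = g x) ↔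
        ∀ j, biproduct.ι F j ≫ f = g (b j) := by
      constructor
      · intro h j
        simpa using h (b j)
      · intro h
        have : (Linear.rightComp k X f).comp (b.constr k (fun j => biproduct.ι F j)) = g :=
          b.ext fun j => by simpa using h j
        exact fun x => LinearMap.congr_fun this x
    refine ⟨biproduct.desc fun j => g (b j), (key _).2 fun j => by simp, fun f hf => ?_⟩
    refine biproduct.hom_ext' _ _ fun j => ?_
    rw [(key f).1 hf j]
    simp

end Copower

/-! ### Coends as universal dinatural families. -/

section NakayamaFamily

variable (k : Type u) [Field k] {C : Type w} [Category.{v} C] [Preadditive C] [Linear k C]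

/-- A dinatural family of linear maps `Hom(M, X)^* → Hom(X, N)`. -/
structure NakayamaFamily (M N : C) where
  map (X : C) : Module.Dual k (M ⟶ X) →ₗ[k] (X ⟶ N)
  dinatural ⦃X Y : C⦄ (f : X ⟶ Y) (φ : Module.Dual k (M ⟶ Y)) :
    map X (dualPost k M f φ) = f ≫ map Y φ

variable {k}

/-- The family is universal, i.e. exhibits `N` as the coend `∫^X Hom(M, X)^* ⊙ X`. -/
def NakayamaFamily.IsUniversal {M N : C} (i : NakayamaFamily k M N) : Prop :=
  ∀ (Y : C) (d : NakayamaFamily k M Y), ∃! f : N ⟶ Y, ∀ X φ, i.map X φ ≫ f = d.map X φ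

theorem NakayamaFamily.IsUniversal.hom_ext {M N Y : C} {i : NakayamaFamily k M N}
    (hi : i.IsUniversal) {f g : N ⟶ Y} (h : ∀ X φ, i.map X φ ≫ f = i.map X φ ≫ g) : f = g :=
  -- Composing `i` with `g` gives a dinatural family to `Y`, through which both `f` and `g` factor
  -- it.
  (hi Y ⟨fun X => (Linear.rightComp k X g).comp (i.map X), fun X Z p φ => by
    simp [i.dinatural]⟩).unique h fun _ _ => rfl

/-- A cowedge of the Nakayama bifunctor is a dinatural family, by the universal property of the
copowers; so the coend can be treated without copowers from here on. -/
theorem hasCoend_of_isUniversal [∀ M X Y : C, HasCopower k (Module.Dual k (M ⟶ X)) Y] {M N : C}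
    (i : NakayamaFamily k M N) (hi : i.IsUniversal) : HasCoend (nakayamaBifunctor k M) := by
  let c : Cowedge (nakayamaBifunctor k M) :=
    Cowedge.mk N (fun X => copowerDesc (i.map X)) (fun X Y f => copower_hom_ext (fun φ => by
      simpa using i.dinatural f φ))
  -- The legs and the cowedge condition are restated with explicit copowers, so that the copower
  -- lemmas apply to them.
  let p (s : Cowedge (nakayamaBifunctor k M)) (X : C) :
      copower k (Module.Dual k (M ⟶ X)) X ⟶ s.pt := s.π X
  have hp (s : Cowedge (nakayamaBifunctor k M)) {X Y : C} (f : X ⟶ Y) :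
      copowerMap (dualPost k M f) (𝟙 X) ≫ p s X = copowerMap LinearMap.id f ≫ p s Y :=
    s.condition f
  let fam (s : Cowedge (nakayamaBifunctor k M)) : NakayamaFamily k M s.pt :=
    ⟨fun X => (Linear.rightComp k X (p s X)).comp (copowerι k _ X), fun X Y f φ => by
      simpa using copowerι k _ X φ ≫= hp s f⟩
  choose d hd hd' using fun s => hi s.pt (fam s)
  refine ⟨⟨⟨c, Multicofork.IsColimit.mk _ d (fun s (X : C) => ?_) (fun s (m : N ⟶ s.pt) hm => ?_)⟩⟩⟩
  · refine copower_hom_ext (fun φ => ?_ : ∀ φ, copowerι k _ X φ ≫ copowerDesc (i.map X) ≫ d s =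
      copowerι k _ X φ ≫ p s X)
    rw [copowerι_desc_assoc]
    exact hd s X φ
  · refine hd' s m fun X φ => ?_
    have h : copowerDesc (i.map X) ≫ m = p s X := hm X
    rw [← copowerι_desc (i.map X), Category.assoc, h]
    rfl

theorem hasNakayama_of_exists_isUniversal [HasFiniteBiproducts C]
    [∀ X Y : C, Module.Finite k (X ⟶ Y)]
    (h : ∀ M : C, ∃ (N : C) (i : NakayamaFamily k M N), i.IsUniversal) : HasNakayama k C :=
  haveI hcop (M X Y : C) : HasCopower k (Module.Dual k (M ⟶ X)) Y := hasCopower_of_finite k _ Y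
  ⟨hcop, fun M => by
    obtain ⟨N, i, hi⟩ := h M
    exact hasCoend_of_isUniversal i hi⟩

variable (k) in
/-- The universal family of the Nakayama functor. -/
def nakayamaFamily [HasNakayama k C] (M : C) : NakayamaFamily k M ((nakayama k C).obj M) where
  map := nakι k M
  dinatural _ _ := nakι_dinatural k M

theorem isUniversal_nakayamaFamily [HasNakayama k C] (M : C) :
    (nakayamaFamily k M).IsUniversal := fun _ d =>
  ⟨nakDesc k d.map d.dinatural, nakι_desc k d.map d.dinatural, fun _ hf =>
    nak_hom_ext k fun X φ => (hf X φ).trans (nakι_desc k d.map d.dinatural X φ).symm⟩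

/-- The Nakayama functor is naturally isomorphic to any functor whose values carry universal
families that are natural in the first variable. -/
theorem nonempty_nakayama_iso [HasNakayama k C] (F : C ⥤ C)
    (i : ∀ M, NakayamaFamily k M (F.obj M)) (hi : ∀ M, (i M).IsUniversal)
    (hF : ∀ ⦃M N : C⦄ (f : M ⟶ N) (X : C) (φ : Module.Dual k (M ⟶ X)),
      (i M).map X φ ≫ F.map f = (i N).map X (dualPre k f X φ)) :
    Nonempty (nakayama k C ≅ F) := by
  choose a ha _ using fun M => isUniversal_nakayamaFamily M _ (i M)
  choose b hb _ using fun M => hi M _ (nakayamaFamily k M)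
  have ha' (M X : C) (φ) : nakι k M X φ ≫ a M = (i M).map X φ := ha M X φ
  have hb' (M X : C) (φ) : (i M).map X φ ≫ b M = nakι k M X φ := hb M X φ
  refine ⟨NatIso.ofComponents (fun M => ⟨a M, b M, ?_, ?_⟩) fun {M N} f => ?_⟩
  · exact nak_hom_ext k fun X φ => by rw [← Category.assoc, ha', hb', Category.comp_id]
  · exact (hi M).hom_ext fun X φ => by rw [← Category.assoc, hb', ha', Category.comp_id]
  · exact nak_hom_ext k fun X φ => by
      dsimp only
      rw [← Category.assoc, ← Category.assoc, nakι_map, ha', ha', hF]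

end NakayamaFamily

/-! ### The Nakayama functor in the presence of a dense object. -/

section Dense

open TensorProduct

variable (k : Type u) [Field k] {C : Type w} [Category.{v} C] [Preadditive C] [Linear k C]

/-- The functor `Hom(P, -)` from `C` to `End(P)`-modules is fully faithful. -/
def IsDenseObject (P : C) : Prop :=
  ∀ (X Y : C) (h : (P ⟶ X) →ₗ[k] (P ⟶ Y)), (∀ (e : P ⟶ P) (p : P ⟶ X), h (e ≫ p) = e ≫ h p) →
    ∃! f : X ⟶ Y, ∀ p : P ⟶ X, p ≫ f = h p

variable {k}

theorem IsDenseObject.hom_ext {P : C} (hP : IsDenseObject k P) {X Y : C} {f g : X ⟶ Y}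
    (h : ∀ p : P ⟶ X, p ≫ f = p ≫ g) : f = g :=
  (hP X Y (Linear.rightComp k P g) fun _ _ => Category.assoc _ _ _).unique h fun _ => rfl

/-- The object is `Hom(M, P)^* ⊗_{End P} P`. Density extends the universal map from `P` to every
`X`: a functional on `Hom(M, X)` pulls back along each `p : P ⟶ X`, and the resulting assignment in
`p` is `End(P)`-equivariant. -/
theorem exists_isUniversal_of_isDenseObject [HasFiniteBiproducts C] [HasCoequalizers C]
    [∀ X Y : C, Module.Finite k (X ⟶ Y)] {P : C} (hP : IsDenseObject k P) (M : C) :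
    ∃ (N : C) (i : NakayamaFamily k M N), i.IsUniversal := by
  have := hasCopower_of_finite k (Module.Dual k (M ⟶ P)) P
  have := hasCopower_of_finite k ((P ⟶ P) ⊗[k] Module.Dual k (M ⟶ P)) P
  let ι := copowerι k (Module.Dual k (M ⟶ P)) P
  let act : (P ⟶ P) →ₗ[k] Module.Dual k (M ⟶ P) →ₗ[k] Module.Dual k (M ⟶ P) :=
    LinearMap.mk₂ k (fun e φ => dualPost k M e φ)
      (fun e e' φ => by ext; simp) (fun r e φ => by ext; simp)
      (fun e φ φ' => by simp) (fun r e φ => by simp)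
  -- On `e ⊗ φ`, the map `s` lets `e` act on the functional and `t` lets it act on `P`; the
  -- coequalizer is the tensor product over `End(P)`.
  let s : copower k ((P ⟶ P) ⊗[k] Module.Dual k (M ⟶ P)) P ⟶ copower k (Module.Dual k (M ⟶ P)) P :=
    copowerDesc (ι.comp (TensorProduct.lift act))
  let t : copower k ((P ⟶ P) ⊗[k] Module.Dual k (M ⟶ P)) P ⟶ copower k (Module.Dual k (M ⟶ P)) P :=
    copowerDesc (TensorProduct.lift ((Linear.comp P P _).compl₂ ι))
  let N := coequalizer s t
  have coeq {Y : C} (g : copower k (Module.Dual k (M ⟶ P)) P ⟶ Y) : s ≫ g = t ≫ g ↔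
      ∀ (e : P ⟶ P) (φ : Module.Dual k (M ⟶ P)), ι (dualPost k M e φ) ≫ g = e ≫ ι φ ≫ g := by
    constructor
    · intro h e φ
      simpa [s, t, act] using copowerι k _ P (e ⊗ₜ φ) ≫= h
    · intro h
      refine copower_hom_ext fun x => ?_
      induction x with
      | zero => simp
      | add x y hx hy => simp only [map_add, Preadditive.add_comp, hx, hy]
      | tmul e φ => simpa [s, t, act] using h e φ
  let q : Module.Dual k (M ⟶ P) →ₗ[k] (P ⟶ N) := (Linear.rightComp k P (coequalizer.π s t)).comp ι
  have hq (e : P ⟶ P) (φ) : q (dualPost k M e φ) = e ≫ q φ :=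
    (coeq _).1 (coequalizer.condition s t) e φ
  have comp {X Y Z : C} (f : X ⟶ Y) (g : Y ⟶ Z) (φ : Module.Dual k (M ⟶ Z)) :
      dualPost k M (f ≫ g) φ = dualPost k M f (dualPost k M g φ) := by ext; simp
  let h (X : C) (φ : Module.Dual k (M ⟶ X)) : (P ⟶ X) →ₗ[k] (P ⟶ N) :=
    { toFun p := q (dualPost k M p φ)
      map_add' p p' := by rw [← map_add]; congr 1; ext; simp
      map_smul' r p := by rw [RingHom.id_apply, ← map_smul]; congr 1; ext; simp }
  have exi (X : C) (φ : Module.Dual k (M ⟶ X)) :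
      ∃ f : X ⟶ N, ∀ p : P ⟶ X, p ≫ f = q (dualPost k M p φ) :=
    (hP X N (h X φ) fun e p => (congrArg q (comp e p φ)).trans (hq e _)).exists
  choose i hi using exi
  let fam : NakayamaFamily k M N :=
    { map X :=
        { toFun := i X
          map_add' φ φ' := hP.hom_ext fun p => by simp [hi]
          map_smul' r φ := hP.hom_ext fun p => by simp [hi] }
      dinatural X Y f φ := hP.hom_ext fun p => by
        change p ≫ i X _ = p ≫ f ≫ i Y φ
        rw [← Category.assoc, hi, hi, comp] }
  -- Evaluation at `p = 𝟙 P`. The coequalizer sees only the component at `P`, so this yields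
  -- uniqueness.
  have fam_P (φ) : i P φ = q φ := by
    have : dualPost k M (𝟙 P) φ = φ := by ext; simp
    simpa [this] using hi P φ (𝟙 P)
  refine ⟨N, fam, fun Y d => ?_⟩
  refine ⟨coequalizer.desc (copowerDesc (d.map P)) ((coeq _).2 fun e φ => ?_), fun X φ => ?_,
    fun f hf => ?_⟩
  · simp only [ι, copowerι_desc]
    exact d.dinatural e φ
  · refine hP.hom_ext fun p => ?_
    change p ≫ i X φ ≫ _ = _
    rw [← Category.assoc, hi, ← d.dinatural]
    simp [q, ι]
  · refine coequalizer.hom_ext (copower_hom_ext fun φ => ?_)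
    have h2 : q φ ≫ f = d.map P φ := by rw [← fam_P]; exact hf P φ
    simpa [q, ι] using h2

end Dense

/-! ### Finite abelian categories: finite-dimensional Hom spaces and a dense object. -/

section FiniteAbelian

variable (k : Type u) [Field k]

/-- Over a finite-dimensional algebra, finitely generated modules are finite-dimensional over `k`,
and `A`-linear maps embed into the `k`-linear ones. -/
theorem module_finite_hom_of_moduleCat {A : Type u} [Ring A] [Algebra k A] [Module.Finite k A]
    (X Y : FGModuleCat.{u} A) : Module.Finite k (X ⟶ Y) := by
  let : Module k X := Module.compHom X (algebraMap k A)
  let : Module k Y := Module.compHom Y (algebraMap k A)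
  have : IsScalarTower k A X := ⟨fun r a x => by
    rw [Algebra.smul_def, mul_smul]; rfl⟩
  have : IsScalarTower k A Y := ⟨fun r a x => by
    rw [Algebra.smul_def, mul_smul]; rfl⟩
  have : Module.Finite k X := Module.Finite.trans A X
  have : Module.Finite k Y := Module.Finite.trans A Y
  let f : (X ⟶ Y) →ₗ[k] (X →ₗ[k] Y) :=
    { toFun g := g.hom.hom.restrictScalars k
      map_add' _ _ := rfl
      map_smul' _ _ := rfl }
  exact Module.Finite.of_injective f fun g g' h => FGModuleCat.hom_ext
    (LinearMap.ext fun x => LinearMap.congr_fun h x)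

variable (C : Type w) [Category.{v} C] [Preadditive C] [Linear k C] [FiniteAbelian k C]

theorem module_finite_hom (X Y : C) : Module.Finite k (X ⟶ Y) := by
  obtain ⟨A, _, _, F, _, _, _, _⟩ := FiniteAbelian.exists_equivalence (k := k) (C := C)
  have := module_finite_hom_of_moduleCat k (F.obj X) (F.obj Y)
  exact Module.Finite.of_injective (F.mapLinearMap k (X := X) (Y := Y)) F.map_injective

/-- An object corresponding to the regular module `A` works, since `Hom(A, X) ≅ X` by evaluation at
`1`. Transported to `P`, evaluation is `el` and its inverse is `pt`. -/
theorem exists_isDenseObject : ∃ P : C, IsDenseObject k P := by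
  obtain ⟨A, _, _, F, _, _, _, _⟩ := FiniteAbelian.exists_equivalence (k := k) (C := C)
  let P := F.objPreimage (FGModuleCat.of A A)
  let e : F.obj P ≅ FGModuleCat.of A A := F.objObjPreimageIso _
  let el {X : C} (p : P ⟶ X) : F.obj X := (F.map p).hom.hom (e.inv.hom.hom (1 : A))
  let pt {X : C} (x : F.obj X) : P ⟶ X :=
    F.preimage (e.hom ≫ FGModuleCat.ofHom (LinearMap.toSpanSingleton A (F.obj X) x))
  have el_pt {X : C} (x : F.obj X) : el (pt x) = x := by
    have : e.hom.hom.hom (e.inv.hom.hom (1 : A)) = (1 : A) :=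
      LinearMap.congr_fun (congrArg (fun f => f.hom.hom) e.inv_hom_id) (1 : A)
    simp only [el, pt, F.map_preimage, FGModuleCat.hom_hom_comp, LinearMap.comp_apply, this]
    exact one_smul A x
  have el_comp {X Y : C} (p : P ⟶ X) (f : X ⟶ Y) : el (p ≫ f) = (F.map f).hom.hom (el p) := by
    simp [el]
  have el_inj {X : C} {p p' : P ⟶ X} (h : el p = el p') : p = p' := by
    apply F.map_injective
    rw [← cancel_epi e.inv]
    refine FGModuleCat.hom_ext (LinearMap.ext_ring h)
  have el_add {X : C} (p p' : P ⟶ X) : el (p + p') = el p + el p' := by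
    simp only [el, F.map_add]; rfl
  refine ⟨P, fun X Y h hh => ?_⟩
  -- Scalars of `A` act as precomposition with endomorphisms of `P`, so an `End(P)`-equivariant map
  -- induces an `A`-linear one.
  have smul_comp {Z : C} (a : A) (p : P ⟶ Z) : el (pt (a • el (𝟙 P)) ≫ p) = a • el p := by
    rw [el_comp, el_pt, map_smul, ← el_comp, Category.id_comp]
  let g : (F.obj X : Type u) →ₗ[A] F.obj Y :=
    { toFun x := el (h (pt x))
      map_add' x y := by
        rw [← el_add, ← map_add]
        congr 2
        exact el_inj (by rw [el_add, el_pt, el_pt, el_pt])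
      map_smul' a x := by
        rw [RingHom.id_apply, ← smul_comp, ← hh]
        congr 2
        exact el_inj (by rw [smul_comp, el_pt, el_pt]) }
  have hg (p : P ⟶ X) : g (el p) = el (h p) := by
    change el (h (pt (el p))) = _
    rw [el_inj (el_pt (el p))]
  refine ⟨F.preimage (FGModuleCat.ofHom g), fun p => el_inj ?_, fun f hf => F.map_injective ?_⟩
  · rw [el_comp, F.map_preimage]
    exact hg p
  · rw [F.map_preimage]
    refine FGModuleCat.hom_ext (LinearMap.ext fun x => ?_)
    change _ = g x
    rw [← el_pt x, hg, ← hf, el_comp]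

end FiniteAbelian

/-! ### Free modules and maps out of the tensor product. -/

section Free

variable {C : Type w} [Category.{v} C] (T : Monad C)

/-- The free `T`-module on `Z`. -/
abbrev freeModule (Z : C) : T.Algebra where
  A := T.obj Z
  a := T.μ.app Z
  unit := T.left_unit Z
  assoc := (T.assoc Z).symm

/-- Functoriality of the free module. -/
abbrev freeModuleMap {Z Z' : C} (f : Z ⟶ Z') : freeModule T Z ⟶ freeModule T Z' where
  f := T.map f
  h := T.μ.naturality f

/-- The action of a `T`-module, as a morphism from the free module on the underlying object. -/
abbrev freeAct (X : T.Algebra) : freeModule T X.A ⟶ X where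
  f := X.a
  h := X.assoc.symm

theorem freeAct_naturality {X Y : T.Algebra} (f : X ⟶ Y) :
    freeModuleMap T f.f ≫ freeAct T Y = freeAct T X ≫ f := Monad.Algebra.Hom.ext f.h

theorem freeModuleMap_η_freeAct (Z : C) :
    freeModuleMap T (Z' := T.obj Z) (T.η.app Z) ≫ freeAct T (freeModule T Z) = 𝟙 _ :=
  Monad.Algebra.Hom.ext (T.right_unit Z)

/-- Transposition under `T^l ⊣ T` carries the two sides of one equation to those of the other,
because the right action is itself defined by its transpose. The left side is the coequalizer
condition, the right side is linearity of `M ⟶ T Z`. -/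
theorem rightActApp_comp_eq_iff {Tl : C ⥤ C} (adj₁ : Tl ⊣ T.toFunctor) (M : T.Algebra) {Z : C}
    (g : Tl.obj M.A ⟶ Z) :
    rightActApp T adj₁ M.A ≫ g = Tl.map M.a ≫ g ↔
      T.map (adj₁.homEquiv _ _ g) ≫ T.μ.app Z = M.a ≫ adj₁.homEquiv _ _ g := by
  rw [← (adj₁.homEquiv _ _).injective.eq_iff, Adjunction.homEquiv_naturality_left,
    Adjunction.homEquiv_naturality_right, rightActApp, Equiv.apply_symm_apply,
    Adjunction.homEquiv_unit, T.map_comp, Category.assoc, Category.assoc]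
  congr! 2
  exact (T.μ.naturality g).symm

variable [HasCoequalizers C] {Tl : C ⥤ C} (adj₁ : Tl ⊣ T.toFunctor)

/-- The morphism of `T`-modules `M ⟶ T Z` corresponding to `T^l ⊗_T M ⟶ Z`. -/
abbrev toFreeModule (M : T.Algebra) {Z : C} (g : tensorObj T adj₁ M ⟶ Z) :
    M ⟶ freeModule T Z where
  f := adj₁.homEquiv _ _ (tensorπ T adj₁ M ≫ g)
  h := (rightActApp_comp_eq_iff T adj₁ M _).1 (by
    rw [← Category.assoc, tensorπ_condition, Category.assoc])

/-- The morphism `T^l ⊗_T M ⟶ Z` corresponding to a morphism of `T`-modules `M ⟶ T Z`. -/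
abbrev ofFreeModule (M : T.Algebra) {Z : C} (p : M ⟶ freeModule T Z) : tensorObj T adj₁ M ⟶ Z :=
  tensorDesc T adj₁ M ((adj₁.homEquiv _ _).symm p.f)
    ((rightActApp_comp_eq_iff T adj₁ M _).2 (by
      rw [Equiv.apply_symm_apply]
      exact p.h))

end Free

/-! ### The adjunction between `T^l ⊗_T (-)` and free modules, and its effect on dual Hom spaces. -/

section TensorFree

variable (k : Type u) [Field k] {C : Type w} [Category.{v} C] [Preadditive C] [Linear k C]
  [HasCoequalizers C]
variable (T : Monad C) [T.toFunctor.Additive] [T.toFunctor.Linear k]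
variable {Tl Tll : C ⥤ C} (adj₂ : Tll ⊣ Tl) (adj₁ : Tl ⊣ T.toFunctor)

/-- The functor `T^l ⊗_T (-)` is left adjoint to the free module functor. -/
def tensorFreeEquiv (M : T.Algebra) (Z : C) :
    (tensorObj T adj₁ M ⟶ Z) ≃ₗ[k] (M ⟶ freeModule T Z) where
  toFun := toFreeModule T adj₁ M
  invFun := ofFreeModule T adj₁ M
  left_inv g := tensor_hom_ext T adj₁ M (by
    rw [tensorπ_desc]
    exact Equiv.symm_apply_apply _ _)
  right_inv p := Monad.Algebra.Hom.ext (by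
    dsimp only
    rw [tensorπ_desc]
    exact Equiv.apply_symm_apply _ _)
  map_add' g g' := Monad.Algebra.Hom.ext (by
    have := adj₁.left_adjoint_additive
    exact (congrArg _ (Preadditive.comp_add _ _ _ _ g g')).trans (adj₁.homAddEquiv_add _ _ _ _))
  map_smul' r g := Monad.Algebra.Hom.ext (by
    have := leftAdjoint_linear k adj₁
    exact (congrArg _ (Linear.comp_smul _ _ _ _ r g)).trans (homEquiv_smul k adj₁ _ _))

theorem tensorFreeEquiv_apply_f (M : T.Algebra) {Z : C} (g : tensorObj T adj₁ M ⟶ Z) :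
    (tensorFreeEquiv k T adj₁ M Z g).f =
      adj₁.unit.app M.A ≫ T.map (tensorπ T adj₁ M ≫ g) := adj₁.homEquiv_unit _ _ _

theorem tensorFreeEquiv_comp (M : T.Algebra) {Z Z' : C} (g : tensorObj T adj₁ M ⟶ Z)
    (f : Z ⟶ Z') : tensorFreeEquiv k T adj₁ M Z' (g ≫ f) =
      tensorFreeEquiv k T adj₁ M Z g ≫ freeModuleMap T f := Monad.Algebra.Hom.ext (by
  rw [Monad.Algebra.comp_f, tensorFreeEquiv_apply_f, tensorFreeEquiv_apply_f,
    ← Category.assoc (tensorπ T adj₁ M), T.map_comp (tensorπ T adj₁ M ≫ g)]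
  exact (Category.assoc _ _ _).symm)

theorem tensorFreeEquiv_tensorMap {M N : T.Algebra} (f : M ⟶ N) {Z : C}
    (g : tensorObj T adj₁ N ⟶ Z) : tensorFreeEquiv k T adj₁ M Z (tensorMap T adj₁ f ≫ g) =
      f ≫ tensorFreeEquiv k T adj₁ N Z g := Monad.Algebra.Hom.ext (by
  rw [Monad.Algebra.comp_f, tensorFreeEquiv_apply_f, tensorFreeEquiv_apply_f,
    ← Category.assoc (tensorπ T adj₁ M), tensorπ_map, Category.assoc, T.map_comp]
  exact adj₁.unit_naturality_assoc _ _)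

/-- Transposing along the coaction of `T^l` corresponds to the multiplication of `T`. -/
theorem tensorFreeEquiv_coact (M : T.Algebra) {Z : C} (g : tensorObj T adj₁ M ⟶ T.obj Z) :
    tensorFreeEquiv k T adj₁ M Z (coact T adj₁ adj₂ (tensorAlgebra T adj₁ adj₂ M) ≫
      Tl.map g ≫ adj₁.counit.app Z) =
      tensorFreeEquiv k T adj₁ M (T.obj Z) g ≫ freeAct T (freeModule T Z) :=
  Monad.Algebra.Hom.ext (by
    have hc : coact T adj₁ adj₂ (tensorAlgebra T adj₁ adj₂ M) = tensorCoact T adj₁ M :=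
      Equiv.apply_symm_apply _ _
    have h : tensorπ T adj₁ M ≫ tensorCoact T adj₁ M ≫ Tl.map g ≫ adj₁.counit.app Z =
        conjδApp T adj₁ M.A ≫ Tl.map (tensorπ T adj₁ M ≫ g) ≫ adj₁.counit.app Z := by
      rw [← Category.assoc, tensorπ_coact, Tl.map_comp]
      simp only [Category.assoc]
    -- The transpose of the transpose of `p` is `p`, by a triangle identity.
    have hη (p : Tl.obj M.A ⟶ T.obj Z) :
        adj₁.unit.app (Tl.obj M.A) ≫ T.map (Tl.map p ≫ adj₁.counit.app Z) = p := by
      rw [T.map_comp]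
      refine (adj₁.unit_naturality_assoc p _).trans ?_
      rw [adj₁.right_triangle_components, Category.comp_id]
    rw [hc, tensorFreeEquiv_apply_f, Monad.Algebra.comp_f, tensorFreeEquiv_apply_f, h,
      unit_conjδ_comp, hη]
    exact (Category.assoc _ _ _).symm)

/-- The linear map `Hom(M, X)^* → Hom(T^l ⊗_T M, X)^*` induced by the adjunction and the action
of `X`. -/
def tensorDual (M X : T.Algebra) :
    Module.Dual k (M ⟶ X) →ₗ[k] Module.Dual k (tensorObj T adj₁ M ⟶ X.A) :=
  ((Linear.rightComp k M (freeAct T X)).comp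
    (tensorFreeEquiv k T adj₁ M X.A).toLinearMap).dualMap

theorem tensorDual_apply (M X : T.Algebra) (φ : Module.Dual k (M ⟶ X))
    (g : tensorObj T adj₁ M ⟶ X.A) : tensorDual k T adj₁ M X φ g =
      φ (tensorFreeEquiv k T adj₁ M X.A g ≫ freeAct T X) := rfl

theorem tensorDual_dualPost (M : T.Algebra) {X Y : T.Algebra} (f : X ⟶ Y)
    (φ : Module.Dual k (M ⟶ Y)) : tensorDual k T adj₁ M X (dualPost k M f φ) =
      dualPost k (tensorObj T adj₁ M) f.f (tensorDual k T adj₁ M Y φ) := by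
  ext g
  simp [tensorDual_apply, tensorFreeEquiv_comp, ← freeAct_naturality]

theorem tensorDual_dualPre {M N : T.Algebra} (f : M ⟶ N) (X : T.Algebra)
    (φ : Module.Dual k (M ⟶ X)) : tensorDual k T adj₁ N X (dualPre k f X φ) =
      dualPre k (tensorMap T adj₁ f) X.A (tensorDual k T adj₁ M X φ) := by
  ext g
  simp [tensorDual_apply, tensorFreeEquiv_tensorMap]

/-- The isomorphism `Hom(T^l ⊗_T M, Z)^* → Hom(M, T Z)^*` given by the adjunction. -/
def freeDual (M : T.Algebra) (Z : C) :
    Module.Dual k (tensorObj T adj₁ M ⟶ Z) →ₗ[k] Module.Dual k (M ⟶ freeModule T Z) :=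
  (tensorFreeEquiv k T adj₁ M Z).symm.toLinearMap.dualMap

theorem freeDual_apply (M : T.Algebra) {Z : C} (ψ : Module.Dual k (tensorObj T adj₁ M ⟶ Z))
    (g : tensorObj T adj₁ M ⟶ Z) :
    freeDual k T adj₁ M Z ψ (tensorFreeEquiv k T adj₁ M Z g) = ψ g :=
  congrArg ψ (LinearEquiv.symm_apply_apply _ _)

theorem freeDual_dualPost (M : T.Algebra) {Z Z' : C} (f : Z ⟶ Z')
    (ψ : Module.Dual k (tensorObj T adj₁ M ⟶ Z')) :
    freeDual k T adj₁ M Z (dualPost k _ f ψ) =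
      dualPost k M (freeModuleMap T f) (freeDual k T adj₁ M Z' ψ) := by
  ext p
  obtain ⟨g, rfl⟩ := (tensorFreeEquiv k T adj₁ M Z).surjective p
  rw [freeDual_apply]
  simp only [LinearMap.dualMap_apply, Linear.rightComp_apply]
  rw [← tensorFreeEquiv_comp, freeDual_apply]

/-- The adjunction isomorphism cancels, leaving only restriction along the action of `X`. This makes
components at free modules determine those at all modules. -/
theorem freeDual_tensorDual (M X : T.Algebra) (φ : Module.Dual k (M ⟶ X)) :
    freeDual k T adj₁ M X.A (tensorDual k T adj₁ M X φ) = dualPost k M (freeAct T X) φ := by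
  ext p
  obtain ⟨g, rfl⟩ := (tensorFreeEquiv k T adj₁ M X.A).surjective p
  rw [freeDual_apply]
  rfl

/-- A triangle identity of the free-forgetful adjunction. Every functional on `Hom(T^l ⊗_T M, Z)`
thus arises from a functional on maps into the free module on `Z`. -/
theorem dualPost_η_tensorDual_freeDual (M : T.Algebra) (Z : C)
    (ψ : Module.Dual k (tensorObj T adj₁ M ⟶ Z)) :
    dualPost k (tensorObj T adj₁ M) (Y := T.obj Z) (T.η.app Z)
      (tensorDual k T adj₁ M (freeModule T Z) (freeDual k T adj₁ M Z ψ)) = ψ := by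
  ext g
  change freeDual k T adj₁ M Z ψ (tensorFreeEquiv k T adj₁ M _ (g ≫ T.η.app Z) ≫ _) = _
  rw [tensorFreeEquiv_comp, Category.assoc, freeModuleMap_η_freeAct, Category.comp_id]
  exact freeDual_apply k T adj₁ M ψ g

/-- This matches the prescribed action on `Nak(T^l ⊗_T M)` with the adjunction: the left side
encodes `can` and the `T^ll`-action through the coaction, the right side only `μ` and transposition.
-/
theorem liftDual_eq_tensorDual (M : T.Algebra) (Z : C)
    (ψ : Module.Dual k (tensorObj T adj₁ M ⟶ Z)) :
    liftDual k T adj₂ adj₁ (tensorAlgebra T adj₁ adj₂ M) Z ψ =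
      tensorDual k T adj₁ M (freeModule T Z) (freeDual k T adj₁ M Z ψ) := by
  ext g
  rw [liftDual_apply, tensorDual_apply]
  exact (freeDual_apply k T adj₁ M ψ _).symm.trans
    (congrArg _ (tensorFreeEquiv_coact k T adj₂ adj₁ M g))

end TensorFree

/-! ### The universal family on the composite functor. -/

section NakayamaAlgebra

variable (k : Type u) [Field k] {C : Type w} [Category.{v} C] [Preadditive C] [Linear k C]
  [HasCoequalizers C] [HasNakayama k C]
variable (T : Monad C) [T.toFunctor.Additive] [T.toFunctor.Linear k]
variable {Tl Tll Tr : C ⥤ C}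
variable (adj₂ : Tll ⊣ Tl) (adj₁ : Tl ⊣ T.toFunctor) (adj₀ : T.toFunctor ⊣ Tr)

/-- The value at `M` of the composite `T-mod ⥤ T^ll-mod ⥤ T-mod`. -/
abbrev tensorLiftObj (M : T.Algebra) : T.Algebra where
  A := (nakayama k C).obj (tensorObj T adj₁ M)
  a := liftAct k T adj₂ adj₁ adj₀ (tensorAlgebra T adj₁ adj₂ M)
  unit := liftAct_unit k T adj₂ adj₁ adj₀ (tensorAlgebra T adj₁ adj₂ M)
  assoc := liftAct_assoc k T adj₂ adj₁ adj₀ (tensorAlgebra T adj₁ adj₂ M)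

/-- The components `Hom(M, X)^* → Hom(X, Nak(T^l ⊗_T M))`. -/
def tensorLiftι (M X : T.Algebra) (φ : Module.Dual k (M ⟶ X)) :
    X ⟶ tensorLiftObj k T adj₂ adj₁ adj₀ M where
  f := nakι k (tensorObj T adj₁ M) X.A (tensorDual k T adj₁ M X φ)
  h := by
    -- On functionals the action gives restriction along `freeAct T X`; dinaturality over the base
    -- category then turns this into precomposition with `X.a`.
    refine (nakι_liftAct k T adj₂ adj₁ adj₀ (tensorAlgebra T adj₁ adj₂ M) X.A _).trans ?_
    rw [liftDual_eq_tensorDual, freeDual_tensorDual, tensorDual_dualPost]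
    exact nakι_dinatural k _ _ _

/-- The family `Hom(M, X)^* → Hom(X, Nak(T^l ⊗_T M))`. -/
def tensorLiftFamily (M : T.Algebra) :
    NakayamaFamily k M (tensorLiftObj k T adj₂ adj₁ adj₀ M) where
  map X :=
    { toFun := tensorLiftι k T adj₂ adj₁ adj₀ M X
      map_add' φ φ' := Monad.Algebra.Hom.ext (by
        simp only [tensorLiftι, map_add]
        rfl)
      map_smul' r φ := Monad.Algebra.Hom.ext (by
        simp only [tensorLiftι, map_smul]
        rfl) }
  dinatural X Y f φ := Monad.Algebra.Hom.ext (by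
    refine (congrArg (nakι k _ X.A) (tensorDual_dualPost k T adj₁ M f φ)).trans ?_
    exact nakι_dinatural k _ _ _)

theorem isUniversal_tensorLiftFamily (M : T.Algebra) :
    (tensorLiftFamily k T adj₂ adj₁ adj₀ M).IsUniversal := by
  intro Y d
  -- The family `d` at free modules, read through `Hom(T^l ⊗_T M, Z)^* ≅ Hom_T(M, T Z)^*` and
  -- restricted along `η` to a morphism out of `Z`.
  let d' : NakayamaFamily k (tensorObj T adj₁ M) Y.A :=
    { map Z :=
        { toFun ψ := T.η.app Z ≫ (d.map (freeModule T Z) (freeDual k T adj₁ M Z ψ)).f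
          map_add' ψ ψ' := by
            rw [map_add, map_add]
            exact Preadditive.comp_add _ _ _ _ _ _
          map_smul' r ψ := by
            rw [map_smul, map_smul]
            exact Linear.comp_smul _ _ _ _ _ _ }
      dinatural Z Z' f ψ := by
        change T.η.app Z ≫ (d.map _ (freeDual k T adj₁ M Z (dualPost k _ f ψ))).f =
          f ≫ T.η.app Z' ≫ _
        rw [freeDual_dualPost, d.dinatural, Monad.Algebra.comp_f, ← Category.assoc,
          ← Category.assoc]
        exact (T.η.naturality f).symm =≫ _ }
  obtain ⟨f, hf, -⟩ := isUniversal_nakayamaFamily (tensorObj T adj₁ M) Y.A d'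
  have hf' (Z : C) (ψ) : nakι k (tensorObj T adj₁ M) Z ψ ≫ f =
      T.η.app Z ≫ (d.map (freeModule T Z) (freeDual k T adj₁ M Z ψ)).f := hf Z ψ
  -- Components at arbitrary modules: `d` is dinatural along the action `T X ⟶ X`, and `η` followed
  -- by the action is the identity.
  have hX (X : T.Algebra) (φ : Module.Dual k (M ⟶ X)) :
      nakι k (tensorObj T adj₁ M) X.A (tensorDual k T adj₁ M X φ) ≫ f = (d.map X φ).f := by
    rw [hf', freeDual_tensorDual, d.dinatural, Monad.Algebra.comp_f, ← Category.assoc]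
    exact (X.unit =≫ _).trans (Category.id_comp _)
  refine ⟨⟨f, ?_⟩, fun X φ => Monad.Algebra.Hom.ext (hX X φ), fun g hg => ?_⟩
  -- Linearity of `f` may be tested after applying `T` to the coprojections, as `T` is a left
  -- adjoint. Both sides equal the component of `d` at the free module on `Z`.
  · refine map_nak_hom_ext k adj₀ fun Z ψ => ?_
    have h1 := nakι_liftAct k T adj₂ adj₁ adj₀ (tensorAlgebra T adj₁ adj₂ M) Z ψ =≫ f
    rw [Category.assoc, liftDual_eq_tensorDual] at h1
    refine Eq.trans ?_ ((hX (freeModule T Z) (freeDual k T adj₁ M Z ψ)).symm.trans h1.symm)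
    rw [← Category.assoc, ← T.map_comp, hf', T.map_comp, Category.assoc, Monad.Algebra.Hom.h]
    exact T.right_unit_assoc Z _
  -- Uniqueness: each coprojection at `Z` is `η` followed by a component of the family at the free
  -- module on `Z`, where `g` is prescribed.
  · refine Monad.Algebra.Hom.ext (nak_hom_ext k fun Z ψ => ?_)
    rw [hf']
    have h2 : nakι k _ (T.obj Z) (tensorDual k T adj₁ M (freeModule T Z) (freeDual k T adj₁ M Z ψ)) ≫
        g.f = _ := congrArg Monad.Algebra.Hom.f (hg (freeModule T Z) (freeDual k T adj₁ M Z ψ))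
    rw [← h2, ← Category.assoc]
    refine Eq.trans ?_ (nakι_dinatural k _ _ _ =≫ g.f)
    rw [dualPost_η_tensorDual_freeDual]

theorem tensorLiftFamily_map_comp {M N : T.Algebra} (f : M ⟶ N) (X : T.Algebra)
    (φ : Module.Dual k (M ⟶ X)) :
    (tensorLiftFamily k T adj₂ adj₁ adj₀ M).map X φ ≫
      (tensor T adj₁ adj₂ ⋙ nakayamaLift k T adj₂ adj₁ adj₀).map f =
      (tensorLiftFamily k T adj₂ adj₁ adj₀ N).map X (dualPre k f X φ) :=
  Monad.Algebra.Hom.ext ((nakι_map k (tensorMap T adj₁ f) X.A _).trans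
    (congrArg (nakι k _ X.A) (tensorDual_dualPre k T adj₁ f X φ).symm))

end NakayamaAlgebra

/-! ### Finiteness and biproducts for modules over a monad. -/

section AlgebraFinite

variable (k : Type u) [Field k] {C : Type w} [Category.{v} C] [Preadditive C] [Linear k C]
variable (T : Monad C) [T.toFunctor.Additive] [T.toFunctor.Linear k]

theorem module_finite_algebra_hom [∀ X Y : C, Module.Finite k (X ⟶ Y)] (M N : T.Algebra) :
    Module.Finite k (M ⟶ N) :=
  Module.Finite.of_injective
    ({ toFun f := f.f, map_add' _ _ := rfl, map_smul' _ _ := rfl } :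
      (M ⟶ N) →ₗ[k] (M.A ⟶ N.A)) fun _ _ h => Monad.Algebra.Hom.ext h

/-- The forgetful functor creates limits, and in a preadditive category finite products are
biproducts. -/
theorem hasFiniteBiproducts_algebra [HasFiniteBiproducts C] : HasFiniteBiproducts T.Algebra :=
  have : HasFiniteProducts T.Algebra :=
    ⟨fun _ => ⟨fun D => Monad.hasLimit_of_comp_forget_hasLimit D⟩⟩
  HasFiniteBiproducts.of_hasFiniteProducts

end AlgebraFinite

end NakMonad

end

theorem theorem4 (k : Type u) [Field k] (M : Type w) [Category.{v} M] [Abelian M] [Linear k M]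
    [NakMonad.FiniteAbelian k M]
    (T : Monad M) [T.toFunctor.Additive] [T.toFunctor.Linear k]
    (Tll Tl Tr Trr : M ⥤ M)
    (adjLL : Tll ⊣ Tl) (adjL : Tl ⊣ T.toFunctor) (adjR : T.toFunctor ⊣ Tr) (_adjRR : Tr ⊣ Trr) :
    ∃ (_ : NakMonad.HasNakayama k M) (_ : NakMonad.HasNakayama k T.Algebra),
      Nonempty (NakMonad.nakayama k T.Algebra ≅
        NakMonad.tensor T adjL adjLL ⋙ NakMonad.nakayamaLift k T adjLL adjL adjR) := by
  have hfin := NakMonad.module_finite_hom k M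
  have hfinT := NakMonad.module_finite_algebra_hom k T
  have : HasFiniteBiproducts M := Abelian.hasFiniteBiproducts
  have := NakMonad.hasFiniteBiproducts_algebra T
  obtain ⟨P, hP⟩ := NakMonad.exists_isDenseObject k M
  have hM : NakMonad.HasNakayama k M :=
    NakMonad.hasNakayama_of_exists_isUniversal (NakMonad.exists_isUniversal_of_isDenseObject hP)
  -- No dense object of `T`-modules is needed: the family on the composite functor already provides
  -- the coends.
  have hT : NakMonad.HasNakayama k T.Algebra :=
    NakMonad.hasNakayama_of_exists_isUniversal fun A =>
      ⟨_, _, NakMonad.isUniversal_tensorLiftFamily k T adjLL adjL adjR A⟩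
  exact ⟨hM, hT, NakMonad.nonempty_nakayama_iso _
    (NakMonad.tensorLiftFamily k T adjLL adjL adjR)
    (NakMonad.isUniversal_tensorLiftFamily k T adjLL adjL adjR)
    fun _ _ => NakMonad.tensorLiftFamily_map_comp k T adjLL adjL adjR⟩
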